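/- Let $V$ be a real vector space of finite dimension, $E=V\oplus iV$ its complexification, and let $F\subset V$ be a connected real-analytic submanifold that is conical, i.e. $x\in T_xF$ for every $x\in F$. Let $M:=F+iV\subset E$ be the tube over $F$ and let $a\in F$. Let $\mathfrak g=\mathfrak{hol}(M,a)$ be the real Lie algebra of germs at $a$ of infinitesimal CR-transformations of $M$, that is (since $M$ is real-analytic and generic in $E$), of germs at $a$ of holomorphic vector fields $f(z)\,\partial/\partial z$ on $E$ with $f(z)\in T_zM$ for all $z\in M$ near $a$. Let $\mathfrak{aut}(M,a)=\{\xi\in\mathfrak g:\xi_a=0\}$, and for $k\ge 0$ let $\mathfrak g_k\subset\mathfrak g$ be the subspace of those germs in $\mathfrak g$ that are represented by a homogeneous polynomial vector field of degree $k+1$ on $E$. Let $\mathrm{Aut}(M,a)$ be the group (under composition) of germs at $a$ of CR-isomorphisms of $M$ fixing $a$, that is, of germs at $a$ of biholomorphic maps $h$ between open neighbourhoods of $a$ in $E$ with $h(a)=a$ such that $h$ and $h^{-1}$ map $M$ into $M$ near $a$. Regard $\mathrm{GL}(V)\subset\mathrm{GL}(E)$ by complex linear extension. Assume that $\mathfrak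 g$ has finite dimension. Then the following conditions are equivalent: (i) $\mathfrak g_1=0$; (ii) $\mathfrak g_k=0$ for all $k\ge 1$; (iii) every germ in $\mathrm{Aut}(M,a)$ is represented by a linear transformation $g\in\mathrm{GL}(V)\subset\mathrm{GL}(E)$ with $g(a)=a$; (iv) the tangential representation $h\mapsto h'(a)$ takes its values in $\mathrm{GL}(V)$ and is a group monomorphism $\mathrm{Aut}(M,a)\hookrightarrow\mathrm{GL}(V)$. Each of these conditions is satisfied if $\mathfrak{aut}(M,a)=0$. Moreover, every element of $\mathfrak g_0$ is of the form $\lambda(z)\,\partial/\partial z$ with $\lambda$ the complex linear extension of an endomorphism of $V$, so that $\mathfrak g_0$ is a linear subspace of $\mathrm{End}(V)$; and if (iv) is satisfied, then the image of the monomorphism in (iv) is contained in the subgroup $$\{g\in\mathrm{GL}(V): g\,\mathfrak g_0=\mathfrak g_0\,g,\ g(a)=a,\ g(T_aF)=T_aF\}.$$ -/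

import Mathlib

open Filter Topology

noncomputable section

namespace TubeCR

/-! ### Submanifolds of vector spaces and their tangent spaces -/

section Real

variable {W : Type*} [NormedAddCommGroup W] [NormedSpace ℝ W]

/-- `S` is a (locally closed) real-analytic submanifold of `W`: near each of its points an analytic
diffeomorphism between open subsets of `W` maps `S` onto a piece of a linear subspace. -/
def IsAnalyticSubmanifold (S : Set W) : Prop :=
  ∀ x ∈ S, ∃ φ : OpenPartialHomeomorph W W, ∃ L : Submodule ℝ W,
    x ∈ φ.source ∧ AnalyticOnNhd ℝ φ φ.source ∧ AnalyticOnNhd ℝ φ.symm φ.target ∧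
      ∀ y ∈ φ.source, y ∈ S ↔ φ y ∈ L

/-- The tangent space of `S ⊆ W` at `x`, as a subspace of `W`: the span of the velocities at `x` of
the curves in `S` through `x` (for a submanifold these velocities already form a subspace). -/
def tangentSpace (S : Set W) (x : W) : Submodule ℝ W :=
  Submodule.span ℝ {v | ∃ γ : ℝ → W, γ 0 = x ∧ (∀ᶠ t in 𝓝 (0 : ℝ), γ t ∈ S) ∧ HasDerivAt γ v 0}

/-- `F` is conical: `x ∈ T_x F` for all `x ∈ F`. -/
def IsConical (F : Set W) : Prop := ∀ x ∈ F, x ∈ tangentSpace F x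

end Real

variable {E : Type*} [NormedAddCommGroup E] [NormedSpace ℂ E]

/-- `E = V ⊕ iV`, that is, the complex space `E` is the complexification of its real
subspace `V`. -/
def IsRealForm (V : Submodule ℝ E) : Prop :=
  ∀ z : E, ∃! p : V × V, z = (p.1 : E) + Complex.I • (p.2 : E)

/-- The tube `F + iV` over `F ⊆ V`. -/
def tube (V : Submodule ℝ E) (F : Set V) : Set E :=
  {z | ∃ x ∈ F, ∃ v : V, z = (x : E) + Complex.I • (v : E)}

/-! ### Germs of holomorphic vector fields -/

/-- `hol(M,a)`: the germs at `a` of holomorphic vector fields `f(z) ∂/∂z` on `E` that are tangent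
to `M`, i.e. `f(z) ∈ T_z M` for all `z ∈ M` near `a`. -/
def hol (M : Set E) (a : E) : Submodule ℝ (Germ (𝓝 a) E) where
  carrier := {ξ | ∃ f : E → E, ξ = (f : Germ (𝓝 a) E) ∧ AnalyticAt ℂ f a ∧
    ∀ᶠ z in 𝓝[M] a, f z ∈ tangentSpace M z}
  add_mem' := by
    rintro _ _ ⟨f, rfl, hf, hf'⟩ ⟨g, rfl, hg, hg'⟩
    exact ⟨f + g, rfl, hf.add hg,
      (hf'.and hg').mono fun z hz => Submodule.add_mem _ hz.1 hz.2⟩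
  zero_mem' := ⟨0, rfl, analyticAt_const, Eventually.of_forall fun z => Submodule.zero_mem _⟩
  smul_mem' := by
    rintro c _ ⟨f, rfl, hf, hf'⟩
    refine ⟨c • f, rfl, ?_, hf'.mono fun z hz => Submodule.smul_mem _ c hz⟩
    have h : c • f = fun z => (c : ℂ) • f z := by
      funext z
      simp
    rw [h]
    exact analyticAt_const.smul hf

/-- `aut(M,a)`: the isotropy subalgebra of the germs in `hol(M,a)` that vanish at `a`. -/
def autAlg (M : Set E) (a : E) : Submodule ℝ (Germ (𝓝 a) E) :=
  hol M a ⊓ LinearMap.ker (Germ.valueₗ : Germ (𝓝 a) E →ₗ[ℝ] E)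

/-- The germs at `a` of the homogeneous polynomial maps `E → E` of degree `m`; these are the maps
`z ↦ p(z, …, z)` with `p` complex `m`-linear. -/
def homogeneousFields (a : E) (m : ℕ) : Submodule ℝ (Germ (𝓝 a) E) where
  carrier := {ξ | ∃ p : MultilinearMap ℂ (fun _ : Fin m => E) E,
    ξ = ((fun z => p fun _ => z : E → E) : Germ (𝓝 a) E)}
  add_mem' := by
    rintro _ _ ⟨p, rfl⟩ ⟨q, rfl⟩
    exact ⟨p + q, rfl⟩
  zero_mem' := ⟨0, rfl⟩
  smul_mem' := by
    rintro c _ ⟨p, rfl⟩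
    refine ⟨(c : ℂ) • p, ?_⟩
    rw [← Germ.coe_smul]
    congr 1

/-- `g_k = hol(M,a) ∩ P_k` for `k ≥ 0`, where `P_k` consists of the homogeneous polynomial vector
fields of degree `k + 1`. -/
def grade (M : Set E) (a : E) (k : ℕ) : Submodule ℝ (Germ (𝓝 a) E) :=
  hol M a ⊓ homogeneousFields a (k + 1)

/-- `g_0`, as a space of endomorphisms of `V`: the `l ∈ End(V)` whose complex linear extension
to `E` belongs to `g_0`. -/
def gradeZeroEnd (V : Submodule ℝ E) (M : Set E) (a : E) : Submodule ℝ (V →ₗ[ℝ] V) where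
  carrier := {l | ∃ L : E →ₗ[ℂ] E, (∀ v : V, L v = l v) ∧ ((L : E → E) : Germ (𝓝 a) E) ∈ grade M a 0}
  add_mem' := by
    rintro _ _ ⟨L, hL, hL'⟩ ⟨K, hK, hK'⟩
    exact ⟨L + K, fun v => by simp [hL, hK], Submodule.add_mem _ hL' hK'⟩
  zero_mem' := ⟨0, fun v => by simp, Submodule.zero_mem _⟩
  smul_mem' := by
    rintro c _ ⟨L, hL, hL'⟩
    refine ⟨(c : ℂ) • L, fun v => by simp [hL], ?_⟩
    have h : (((c : ℂ) • L : E →ₗ[ℂ] E) : E → E) = c • (L : E → E) := by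
      funext z
      simp
    rw [h]
    exact Submodule.smul_mem _ c hL'

/-! ### The stability group -/

/-- The germs at `a` of holomorphic maps `h` with `h(a) = a` that map `M` into `M` near `a`. -/
def SelfGerm (M : Set E) (a : E) : Type _ :=
  {φ : Germ (𝓝 a) E // ∃ h : E → E, φ = (h : Germ (𝓝 a) E) ∧ AnalyticAt ℂ h a ∧ h a = a ∧
    ∀ᶠ z in 𝓝[M] a, h z ∈ M}

namespace SelfGerm

variable {M : Set E} {a : E}

theorem tendsto (φ : SelfGerm M a) : φ.1.Tendsto (𝓝 a) := by
  obtain ⟨h, e, hh, ha, -⟩ := φ.2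
  rw [e]
  have := hh.continuousAt.tendsto
  rw [ha] at this
  exact this

/-- Germs are multiplied by composition. -/
instance : Monoid (SelfGerm M a) where
  mul φ ψ := ⟨φ.1.compTendsto' ψ.1 ψ.tendsto, by
    obtain ⟨_, f, rfl, hf, hfa, hfM⟩ := φ
    obtain ⟨_, g, rfl, hg, hga, hgM⟩ := ψ
    have hf' : AnalyticAt ℂ f (g a) := by rwa [hga]
    refine ⟨f ∘ g, rfl, hf'.comp hg, by simp [hga, hfa], ?_⟩
    have ht : Tendsto g (𝓝[M] a) (𝓝[M] a) := by
      refine tendsto_nhdsWithin_iff.2 ⟨?_, hgM⟩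
      have := hg.continuousAt.tendsto
      rw [hga] at this
      exact this.mono_left nhdsWithin_le_nhds
    exact ht.eventually hfM⟩
  one := ⟨((id : E → E) : Germ (𝓝 a) E), id, rfl, analyticAt_id, rfl, eventually_mem_nhdsWithin⟩
  mul_assoc φ ψ χ := by
    obtain ⟨_, f, rfl, -⟩ := φ
    obtain ⟨_, g, rfl, -⟩ := ψ
    obtain ⟨_, h, rfl, -⟩ := χ
    rfl
  one_mul φ := by
    obtain ⟨_, f, rfl, -⟩ := φ
    rfl
  mul_one φ := by
    obtain ⟨_, f, rfl, -⟩ := φ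
    rfl

/-- The derivative `h'(a)` of a germ `h`. -/
def differential (φ : SelfGerm M a) : E →L[ℂ] E :=
  φ.1.liftOn (fun f => fderiv ℂ f a) fun _ _ h => EventuallyEq.fderiv_eq h

end SelfGerm

/-- The stability group `Aut(M,a)`: the germs at `a` of biholomorphic maps `h` with `h(a) = a` such
that both `h` and `h⁻¹` map `M` into `M` near `a`. -/
abbrev Stab (M : Set E) (a : E) : Type _ := (SelfGerm M a)ˣ

/-- Every germ in `Aut(M,a)` is represented by (the complex linear extension of) some `g ∈ GL(V)`
with `g(a) = a`. -/
def StabIsLinear (V : Submodule ℝ E) (M : Set E) (a : V) : Prop :=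
  ∀ h : Stab M (a : E), ∃ g : V ≃ₗ[ℝ] V, g a = a ∧
    ∃ G : E →ₗ[ℂ] E, (∀ v : V, G v = g v) ∧ h.val.val = ((G : E → E) : Germ (𝓝 (a : E)) E)

/-- The group homomorphism `ρ : Aut(M,a) → GL(V)` is the tangential representation: the complex
linear extension of `ρ(h)` is `h'(a)`. -/
def IsTangentialRep (V : Submodule ℝ E) (M : Set E) (a : E) (ρ : Stab M a →* (V ≃ₗ[ℝ] V)) : Prop :=
  ∀ (h : Stab M a) (v : V), h.val.differential (v : E) = ρ h v

/-- The tangential representation `h ↦ h'(a)` is a group monomorphism `Aut(M,a) → GL(V)`. -/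
def TangentialRepIsMono (V : Submodule ℝ E) (M : Set E) (a : E) : Prop :=
  ∃ ρ : Stab M a →* (V ≃ₗ[ℝ] V), IsTangentialRep V M a ρ ∧ Function.Injective ρ

/-- The subgroup `{g ∈ GL(V) : g g₀ = g₀ g, g(a) = a, g(T) = T}` of `GL(V)`. -/
def normalizerGroup {V : Type*} [AddCommGroup V] [Module ℝ V] (g₀ : Submodule ℝ (V →ₗ[ℝ] V))
    (a : V) (T : Submodule ℝ V) : Subgroup (V ≃ₗ[ℝ] V) where
  carrier := {g | (fun l : V →ₗ[ℝ] V => (g : V →ₗ[ℝ] V) ∘ₗ l) '' (g₀ : Set (V →ₗ[ℝ] V)) =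
      (fun l : V →ₗ[ℝ] V => l ∘ₗ (g : V →ₗ[ℝ] V)) '' (g₀ : Set (V →ₗ[ℝ] V)) ∧
    g a = a ∧ g '' (T : Set V) = T}
  mul_mem' := by
    rintro g h ⟨hg, hga, hgT⟩ ⟨hh, hha, hhT⟩
    refine ⟨?_, by simp [hha, hga], ?_⟩
    · have e1 : (fun l : V →ₗ[ℝ] V => ((g * h : V ≃ₗ[ℝ] V) : V →ₗ[ℝ] V) ∘ₗ l) =
          (fun l => (g : V →ₗ[ℝ] V) ∘ₗ l) ∘ (fun l => (h : V →ₗ[ℝ] V) ∘ₗ l) := rfl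
      have e2 : (fun l : V →ₗ[ℝ] V => l ∘ₗ ((g * h : V ≃ₗ[ℝ] V) : V →ₗ[ℝ] V)) =
          (fun l => l ∘ₗ (h : V →ₗ[ℝ] V)) ∘ (fun l => l ∘ₗ (g : V →ₗ[ℝ] V)) := rfl
      have e3 : (fun l : V →ₗ[ℝ] V => (g : V →ₗ[ℝ] V) ∘ₗ l) ∘ (fun l => l ∘ₗ (h : V →ₗ[ℝ] V)) =
          (fun l => l ∘ₗ (h : V →ₗ[ℝ] V)) ∘ (fun l => (g : V →ₗ[ℝ] V) ∘ₗ l) := rfl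
      rw [e1, e2, Set.image_comp, hh, ← Set.image_comp, e3, Set.image_comp, hg, ← Set.image_comp]
    · have e : ⇑(g * h : V ≃ₗ[ℝ] V) = g ∘ h := rfl
      rw [e, Set.image_comp, hhT, hgT]
  one_mem' := ⟨rfl, rfl, Set.image_id _⟩
  inv_mem' := by
    rintro g ⟨hg, hga, hgT⟩
    have r1 : ∀ x, g (g⁻¹ x) = x := fun x => g.apply_symm_apply x
    have r2 : ∀ x, g⁻¹ (g x) = x := fun x => g.symm_apply_apply x
    refine ⟨?_, by rw [← hga, r2, hga], ?_⟩
    · ext m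
      constructor
      · rintro ⟨l, hl, rfl⟩
        obtain ⟨k, hk, e⟩ := hg.ge (Set.mem_image_of_mem _ hl)
        refine ⟨k, hk, LinearMap.ext fun x => ?_⟩
        have := LinearMap.congr_fun e (g⁻¹ x)
        simp only [LinearMap.comp_apply, LinearEquiv.coe_coe, r1] at this ⊢
        rw [← this, r2]
      · rintro ⟨l, hl, rfl⟩
        obtain ⟨k, hk, e⟩ := hg.le (Set.mem_image_of_mem _ hl)
        refine ⟨k, hk, LinearMap.ext fun x => ?_⟩
        have := LinearMap.congr_fun e (g⁻¹ x)
        simp only [LinearMap.comp_apply, LinearEquiv.coe_coe, r1] at this ⊢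
        rw [this, r2]
    · nth_rewrite 1 [← hgT]
      rw [← Set.image_comp]
      have : ⇑(g⁻¹ : V ≃ₗ[ℝ] V) ∘ ⇑g = id := funext r2
      rw [this, Set.image_id]

end TubeCR

end

/-!
Write `M = F + iV`, and `g = hol(M,a)`. As `M` is invariant under the translations by `iV`, and
locally under dilations because `F` is conical, `g` is stable under the derivations `T_v` along the
constant fields `iv` and under the derivation `R` along the Euler field `z`. From `[T_v, R] = T_v`
and `dim g < ∞` it follows that every `T_v` is nilpotent
(`IsRealForm.isNilpotent_imagDeriv`). Consequently the constant fields in `g` are exactly those with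
values in `iV` (`IsRealForm.const_mem_hol_iff`); differentiating along `iV` then shows that linear
fields in `g` preserve `V`, and that quadratic fields in `g` map `V` to `iV`.

*Vanishing of `g₁` implies linearity.* If some `f` in `g` is not affine then, the `T_v` being
commuting and nilpotent, one finds a non-affine `f` whose third derivative vanishes, and `R(R - 1)f`
is a nonzero element of `g₁`. So if `g₁ = 0` then `g` consists of affine fields
(`IsRealForm.eventually_eq_affine_of_grade_one`), and all `g_k` with `k ≥ 1` vanish. Moreover an
automorphism germ `h` then transforms the complex field `z - a`, which is a complex combination of
the Euler field and the constant `ia`, into an affine field vanishing at `a` with derivative the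
identity, that is, into `z - a`. Hence `h` is affine, and its action on the constants `iv` and on
the Euler field shows that it is linear and preserves `V` (`IsRealForm.exists_linear_of_grade_one`).
For linear germs the tangential representation is injective.

*Injectivity of the tangential representation implies that `g₁` vanishes.* For a field `q` in `g₁`
the field `q(z) - q(a) = A(z - a) + q(z - a)` lies in `g`, vanishes at `a`, and its linear part `A`
maps `V` to `iV`. Its flow is constructed by the implicit function theorem in a space of continuous
functions (`exists_flow`), and preserves `M` by a Gronwall argument in a chart of `F`
(`exists_nhds_integralCurve_mem`), so it consists of automorphisms. Since their differentials
`exp(sA)` preserve `V`, so does `A`. Therefore `A = 0`, all the differentials are trivial, the flow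
is trivial by injectivity, and `q = 0` (`IsRealForm.grade_one_eq_bot_of_mono`).
-/

namespace TubeCR

/-! ### Tangent spaces -/

section Tangent

variable {W W' : Type*} [NormedAddCommGroup W] [NormedSpace ℝ W]
  [NormedAddCommGroup W'] [NormedSpace ℝ W']

theorem hasDerivAt_mem_of_isClosed {L : Submodule ℝ W} (hL : IsClosed (L : Set W)) {γ : ℝ → W}
    {v : W} {t₀ : ℝ} (hγ : HasDerivAt γ v t₀) (h : ∀ᶠ t in 𝓝 t₀, γ t ∈ L) : v ∈ L := by
  refine hL.mem_of_tendsto (hasDerivAt_iff_tendsto_slope.1 hγ) ?_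
  filter_upwards [h.filter_mono nhdsWithin_le_nhds] with t ht
  exact L.smul_mem _ (L.sub_mem ht h.self_of_nhds)

theorem mem_tangentSpace_of_curve {S : Set W} {x v : W} {γ : ℝ → W} (h0 : γ 0 = x)
    (hS : ∀ᶠ t in 𝓝 (0 : ℝ), γ t ∈ S) (hγ : HasDerivAt γ v 0) : v ∈ tangentSpace S x :=
  Submodule.subset_span ⟨γ, h0, hS, hγ⟩

theorem tangentSpace_submodule_le {L : Submodule ℝ W} (hL : IsClosed (L : Set W)) (x : W) :
    tangentSpace (L : Set W) x ≤ L := by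
  refine Submodule.span_le.2 ?_
  rintro v ⟨γ, -, hS, hγ⟩
  exact hasDerivAt_mem_of_isClosed hL hγ hS

/-- The differential of a map sending `S` into `S'` near `x` maps `T_x S` into `T_{f(x)} S'`. -/
theorem map_mem_tangentSpace {S : Set W} {S' : Set W'} {f : W → W'} {f' : W →L[ℝ] W'} {x : W}
    (hf : HasFDerivAt f f' x) (hS : ∀ᶠ y in 𝓝[S] x, f y ∈ S') {v : W}
    (hv : v ∈ tangentSpace S x) : f' v ∈ tangentSpace S' (f x) := by
  suffices h : tangentSpace S x ≤ (tangentSpace S' (f x)).comap (f' : W →ₗ[ℝ] W') from h hv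
  refine Submodule.span_le.2 ?_
  rintro v ⟨γ, rfl, hγS, hγ⟩
  have ht : Tendsto γ (𝓝 0) (𝓝[S] (γ 0)) :=
    tendsto_nhdsWithin_iff.2 ⟨hγ.continuousAt, hγS⟩
  exact mem_tangentSpace_of_curve (γ := f ∘ γ) rfl (ht.eventually hS)
    (hf.comp_hasDerivAt (0 : ℝ) hγ)

end Tangent

/-! ### Real forms and tubes -/

section RealForm

variable {E : Type*} [NormedAddCommGroup E] [NormedSpace ℂ E] {V : Submodule ℝ E}

/-- The real isomorphism `V × V ≃ E`, `(v, w) ↦ v + iw`, given by a real form `V` of `E`. -/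
noncomputable def IsRealForm.equiv (hV : IsRealForm V) : (V × V) ≃ₗ[ℝ] E :=
  LinearEquiv.ofBijective
    (V.subtype.coprod (((Complex.I • LinearMap.id : E →ₗ[ℂ] E).restrictScalars ℝ) ∘ₗ V.subtype)) <|
    Function.bijective_iff_existsUnique _ |>.2 fun z => by
      simpa [eq_comm] using hV z

theorem IsRealForm.equiv_apply (hV : IsRealForm V) (p : V × V) :
    hV.equiv p = (p.1 : E) + Complex.I • (p.2 : E) := by
  simp [IsRealForm.equiv]

variable [FiniteDimensional ℂ E]

/-- The projection `E = V ⊕ iV → V` to the real part. -/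
noncomputable def IsRealForm.re (hV : IsRealForm V) : E →L[ℝ] V :=
  haveI := FiniteDimensional.complexToReal E
  LinearMap.toContinuousLinearMap (LinearMap.fst ℝ V V ∘ₗ hV.equiv.symm.toLinearMap)

/-- The projection `E = V ⊕ iV → V` to the imaginary part. -/
noncomputable def IsRealForm.im (hV : IsRealForm V) : E →L[ℝ] V :=
  haveI := FiniteDimensional.complexToReal E
  LinearMap.toContinuousLinearMap (LinearMap.snd ℝ V V ∘ₗ hV.equiv.symm.toLinearMap)

theorem IsRealForm.re_add_im (hV : IsRealForm V) (z : E) :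
    (hV.re z : E) + Complex.I • (hV.im z : E) = z := by
  have := hV.equiv.apply_symm_apply z
  rw [hV.equiv_apply] at this
  exact this

theorem IsRealForm.re_mk (hV : IsRealForm V) (v w : V) :
    hV.re ((v : E) + Complex.I • (w : E)) = v := by
  have := hV.equiv.symm_apply_apply (v, w)
  rw [hV.equiv_apply] at this
  exact congrArg Prod.fst this

theorem IsRealForm.im_mk (hV : IsRealForm V) (v w : V) :
    hV.im ((v : E) + Complex.I • (w : E)) = w := by
  have := hV.equiv.symm_apply_apply (v, w)
  rw [hV.equiv_apply] at this
  exact congrArg Prod.snd this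

@[simp] theorem IsRealForm.re_coe (hV : IsRealForm V) (v : V) : hV.re (v : E) = v := by
  simpa using hV.re_mk v 0

@[simp] theorem IsRealForm.im_coe (hV : IsRealForm V) (v : V) : hV.im (v : E) = 0 := by
  simpa using hV.im_mk v 0

theorem IsRealForm.re_I_smul (hV : IsRealForm V) (z : E) :
    hV.re (Complex.I • z) = -hV.im z := by
  have h : Complex.I • z = ((-hV.im z : V) : E) + Complex.I • ((hV.re z : V) : E) := by
    conv_lhs => rw [← hV.re_add_im z]
    rw [smul_add, smul_smul, Complex.I_mul_I]
    simp [add_comm]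
  rw [h, hV.re_mk]

theorem IsRealForm.im_I_smul (hV : IsRealForm V) (z : E) :
    hV.im (Complex.I • z) = hV.re z := by
  have h := hV.re_I_smul (Complex.I • z)
  rw [smul_smul, Complex.I_mul_I] at h
  simpa using h.symm

@[simp] theorem IsRealForm.re_I_smul_coe (hV : IsRealForm V) (v : V) :
    hV.re (Complex.I • (v : E)) = 0 := by
  simp [hV.re_I_smul]

theorem IsRealForm.eq_coe_re (hV : IsRealForm V) {z : E} (h : hV.im z = 0) :
    z = (hV.re z : E) := by
  conv_lhs => rw [← hV.re_add_im z, h]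
  simp

theorem IsRealForm.linearMap_ext (hV : IsRealForm V) {E' : Type*} [AddCommGroup E'] [Module ℂ E']
    {L K : E →ₗ[ℂ] E'} (h : ∀ v : V, L v = K v) : L = K := by
  ext z
  rw [← hV.re_add_im z]
  simp [h]

theorem IsRealForm.mem_tube_iff (hV : IsRealForm V) {F : Set V} {z : E} :
    z ∈ tube V F ↔ hV.re z ∈ F := by
  constructor
  · rintro ⟨x, hx, v, rfl⟩
    rwa [hV.re_mk]
  · intro h
    exact ⟨_, h, _, (hV.re_add_im z).symm⟩

/-- `T_z (F + iV) = T_{Re z} F + iV`. -/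
theorem IsRealForm.mem_tangentSpace_tube_iff (hV : IsRealForm V) {F : Set V} {z w : E}
    (hz : z ∈ tube V F) :
    w ∈ tangentSpace (tube V F) z ↔ hV.re w ∈ tangentSpace F (hV.re z) := by
  constructor
  · intro h
    exact map_mem_tangentSpace (hV.re.hasFDerivAt)
      (eventually_mem_nhdsWithin.mono fun y hy => hV.mem_tube_iff.1 hy) h
  · intro h
    rw [← hV.re_add_im w]
    refine Submodule.add_mem _ ?_ ?_
    · have hd : HasFDerivAt (fun x : V => (x : E) + Complex.I • (hV.im z : E)) V.subtypeL
          (hV.re z) := V.subtypeL.hasFDerivAt.add_const _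
      have := map_mem_tangentSpace (S' := tube V F) hd
        (eventually_mem_nhdsWithin.mono fun y hy => ⟨y, hy, _, rfl⟩) h
      rwa [hV.re_add_im] at this
    · refine mem_tangentSpace_of_curve (γ := fun t : ℝ => z + t • (Complex.I • (hV.im w : E)))
        (by simp) (Eventually.of_forall fun t => ?_) ?_
      · rw [hV.mem_tube_iff] at hz ⊢
        simpa using hz
      · simpa using ((hasDerivAt_id (0 : ℝ)).smul_const (Complex.I • (hV.im w : E))).const_add z

end RealForm

/-! ### Integral curves of tangent vector fields -/

section IntegralCurve

variable {W Y : Type*} [NormedAddCommGroup W] [NormedSpace ℝ W] [FiniteDimensional ℝ W]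
  [NormedAddCommGroup Y] [NormedSpace ℝ Y]

/-- Integral curves of a vector field tangent to a submanifold `S` stay in `S` once they start
there. The field may depend on a parameter `y ∈ Y`, which is allowed to vary along the curve; the
neighbourhood `U` confines the curve to a single chart of `S`. In that chart, the distance `w` of
the curve from the linear model of `S` satisfies `‖w'‖ ≤ K ‖w‖`, so that `w` vanishes. -/
theorem exists_nhds_integralCurve_mem {S : Set W} (hS : IsAnalyticSubmanifold S) {x₀ : W}
    (hx₀ : x₀ ∈ S) {y₀ : Y} {X : W × Y → W} (hX : ContDiffAt ℝ 1 X (x₀, y₀))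
    (hXS : ∀ᶠ p in 𝓝 (x₀, y₀), p.1 ∈ S → X p ∈ tangentSpace S p.1) :
    ∃ U ∈ 𝓝 (x₀, y₀), ∀ c : ℝ → W × Y, ContinuousOn (fun t => (c t).1) (Set.Icc 0 1) →
      (∀ t ∈ Set.Ico (0 : ℝ) 1, HasDerivWithinAt (fun t => (c t).1) (X (c t)) (Set.Ici t) t) →
      (∀ t ∈ Set.Icc (0 : ℝ) 1, c t ∈ U) → (c 0).1 ∈ S → ∀ t ∈ Set.Icc (0 : ℝ) 1, (c t).1 ∈ S := by
  obtain ⟨φ, L, hxφ, hφ, hφs, hφL⟩ := hS x₀ hx₀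
  obtain ⟨P₀, hP₀⟩ := Submodule.ClosedComplemented.of_finiteDimensional_quotient
    (p := L) L.closed_of_finiteDimensional
  -- `P` is a linear projection onto the model space `L`, and `r` the induced retraction onto `S`.
  let P : W →L[ℝ] W := L.subtypeL ∘L P₀
  have hPL : ∀ w, P w ∈ L := fun w => (P₀ w).2
  have hPid : ∀ w ∈ L, P w = w := fun w hw => congrArg Subtype.val (hP₀ ⟨w, hw⟩)
  let r : W → W := fun x => φ.symm (P (φ x))
  have hφx₀ : P (φ x₀) = φ x₀ := hPid _ ((hφL x₀ hxφ).1 hx₀)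
  have hr₀ : r x₀ = x₀ := by simp only [r, hφx₀]; exact φ.left_inv hxφ
  have hφan : AnalyticAt ℝ φ x₀ := hφ x₀ hxφ
  have hφsan : AnalyticAt ℝ φ.symm (φ x₀) := hφs _ (φ.map_source hxφ)
  have hPφ : ContinuousAt (fun x => P (φ x)) x₀ := P.continuous.continuousAt.comp hφan.continuousAt
  have hPφt : Tendsto (fun x => P (φ x)) (𝓝 x₀) (𝓝 (φ x₀)) := by
    have := hPφ.tendsto; rwa [hφx₀] at this
  have hrt : Tendsto r (𝓝 x₀) (𝓝 x₀) := by
    have := hφsan.continuousAt.tendsto.comp hPφt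
    rwa [φ.left_inv hxφ] at this
  -- the normal component of the field in the chart
  let G : W × Y → W := fun p => (ContinuousLinearMap.id ℝ W - P) (fderiv ℝ φ p.1 (X p))
  have hG : ContDiffAt ℝ 1 G (x₀, y₀) := by
    have h1 : ContDiffAt ℝ 1 (fun p : W × Y => fderiv ℝ φ p.1) (x₀, y₀) :=
      ContDiffAt.comp (x₀, y₀) (hφan.fderiv.contDiffAt (n := 1)) contDiffAt_fst
    exact (ContinuousLinearMap.contDiff _).contDiffAt.comp _ (h1.clm_apply hX)
  obtain ⟨K, t, ht, hK⟩ := hG.exists_lipschitzOnWith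
  obtain ⟨K', t', ht', hK'⟩ := (hφsan.contDiffAt (n := 1)).exists_lipschitzOnWith
  have hfst : Tendsto (Prod.fst : W × Y → W) (𝓝 (x₀, y₀)) (𝓝 x₀) := continuousAt_fst
  have hsnd : Tendsto (Prod.snd : W × Y → Y) (𝓝 (x₀, y₀)) (𝓝 y₀) := continuousAt_snd
  have hrp : Tendsto (fun p : W × Y => (r p.1, p.2)) (𝓝 (x₀, y₀)) (𝓝 (x₀, y₀)) :=
    (hrt.comp hfst).prodMk_nhds hsnd
  have hsrc : φ.source ∈ 𝓝 x₀ := φ.open_source.mem_nhds hxφ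
  have htgt : φ.target ∈ 𝓝 (φ x₀) := φ.open_target.mem_nhds (φ.map_source hxφ)
  refine ⟨{p | p.1 ∈ φ.source ∧ p ∈ t ∧ (r p.1, p.2) ∈ t ∧ P (φ p.1) ∈ φ.target ∧
    φ p.1 ∈ t' ∧ P (φ p.1) ∈ t' ∧ (r p.1 ∈ S → X (r p.1, p.2) ∈ tangentSpace S (r p.1))}, ?_, ?_⟩
  · filter_upwards [hfst.eventually hsrc, ht, hrp.eventually ht,
      (hPφt.comp hfst).eventually htgt, (hφan.continuousAt.tendsto.comp hfst).eventually ht',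
      (hPφt.comp hfst).eventually ht', hrp.eventually hXS] with p h1 h2 h3 h4 h5 h6 h7
    exact ⟨h1, h2, h3, h4, h5, h6, h7⟩
  intro c hc hc' hcU hc0
  have hN : ∀ s ∈ Set.Icc (0 : ℝ) 1, (ContinuousLinearMap.id ℝ W - P) (φ (c s).1) = 0 := by
    refine eq_zero_of_abs_deriv_le_mul_abs_self_of_eq_zero_right (f' := fun s => G (c s))
      (K := K * K') ?_ ?_ ?_ ?_
    · intro s hs
      have h1 := (hφ _ (hcU s hs).1).continuousAt
      exact (ContinuousLinearMap.continuous _).continuousAt.comp_continuousWithinAt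
        (ContinuousAt.comp_continuousWithinAt h1 (hc s hs))
    · intro s hs
      have h1 := (hφ _ (hcU s ⟨hs.1, hs.2.le⟩).1).differentiableAt.hasFDerivAt
      exact (ContinuousLinearMap.hasFDerivAt _).comp_hasDerivWithinAt s
        (h1.comp_hasDerivWithinAt s (hc' s hs))
    · have h := hcU 0 (by simp)
      simp [hPid _ ((hφL _ h.1).1 hc0)]
    · intro s hs
      obtain ⟨h1, h2, h3, h4, h5, h6, h7⟩ := hcU s ⟨hs.1, hs.2.le⟩
      set p := c s
      have hrs : r p.1 ∈ φ.source := φ.map_target h4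
      have hφr : φ (r p.1) = P (φ p.1) := φ.right_inv h4
      have hrS : r p.1 ∈ S := (hφL _ hrs).2 (hφr ▸ hPL _)
      have hG0 : G (r p.1, p.2) = 0 := by
        have hev : ∀ᶠ y in 𝓝[S] (r p.1), φ y ∈ (L : Set W) := by
          filter_upwards [eventually_mem_nhdsWithin,
            mem_nhdsWithin_of_mem_nhds (φ.open_source.mem_nhds hrs)] with y hy hys
          exact (hφL y hys).1 hy
        have hmem := map_mem_tangentSpace (hφ _ hrs).differentiableAt.hasFDerivAt hev (h7 hrS)
        have hL := tangentSpace_submodule_le L.closed_of_finiteDimensional _ hmem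
        simp [G, hPid _ hL]
      have e1 : ‖G p‖ ≤ K * ‖p.1 - r p.1‖ := by
        have := hK.norm_sub_le h2 h3
        rw [hG0, sub_zero] at this
        refine this.trans_eq ?_
        congr 1
        simp [Prod.norm_def, p]
      have e2 : ‖p.1 - r p.1‖ ≤ K' * ‖φ p.1 - P (φ p.1)‖ := by
        have := hK'.norm_sub_le h5 h6
        rwa [φ.left_inv h1] at this
      calc ‖G p‖ ≤ K * ‖p.1 - r p.1‖ := e1
        _ ≤ K * (K' * ‖φ p.1 - P (φ p.1)‖) := by gcongr
        _ = _ := by simp [mul_assoc]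
  intro s hs
  have h := hN s hs
  simp only [sub_apply, ContinuousLinearMap.id_apply, sub_eq_zero] at h
  exact (hφL _ (hcU s hs).1).2 (h ▸ hPL _)

/-- A conical submanifold is locally invariant under dilations. -/
theorem exists_nhds_exp_smul_mem {F : Set W} (hF : IsAnalyticSubmanifold F) (hcon : IsConical F)
    {x₀ : W} (hx₀ : x₀ ∈ F) :
    ∃ U ∈ 𝓝 x₀, ∀ᶠ s in 𝓝 (0 : ℝ), ∀ x ∈ U, x ∈ F → Real.exp s • x ∈ F := by
  obtain ⟨U, hU, h⟩ := exists_nhds_integralCurve_mem hF hx₀ (y₀ := (0 : ℝ))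
    (X := fun p => p.2 • p.1) (contDiffAt_snd.smul contDiffAt_fst)
    (Eventually.of_forall fun p hp => Submodule.smul_mem _ _ (hcon _ hp))
  -- on a small neighbourhood of `x₀` the whole segment of the dilation flow remains in `U`
  have hev : ∀ t ∈ Set.Icc (0 : ℝ) 1, ∀ᶠ q in 𝓝 ((x₀, (0 : ℝ)), t),
      (Real.exp (q.2 * q.1.2) • q.1.1, q.1.2) ∈ U := by
    intro t _
    have hc : Continuous fun q : (W × ℝ) × ℝ => (Real.exp (q.2 * q.1.2) • q.1.1, q.1.2) := by
      fun_prop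
    refine hc.continuousAt.eventually ?_
    simpa using hU
  have hev' := isCompact_Icc.eventually_forall_of_forall_eventually (x₀ := (x₀, (0 : ℝ)))
    (P := fun p t => (Real.exp (t * p.2) • p.1, p.2) ∈ U) hev
  rw [nhds_prod_eq] at hev'
  obtain ⟨pa, hpa, pb, hpb, hp⟩ := eventually_prod_iff.1 hev'
  refine ⟨{x | pa x}, hpa, hpb.mono fun s hs x hx hxF => ?_⟩
  have := h (fun t => (Real.exp (t * s) • x, s)) (by fun_prop) ?_ (fun t ht => hp hx hs t ht)
    (by simpa using hxF) 1 (by simp)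
  · simpa using this
  · intro t _
    have hd : HasDerivAt (fun t : ℝ => Real.exp (t * s) • x) ((Real.exp (t * s) * s) • x) t := by
      have := ((hasDerivAt_id t).mul_const s).exp.smul_const x
      simpa using this
    have e : s • Real.exp (t * s) • x = (Real.exp (t * s) * s) • x := by
      rw [smul_smul, mul_comm]
    simpa only [e] using hd.hasDerivWithinAt

end IntegralCurve

theorem completeSpace_of_finiteDimensional_complex (E : Type*) [NormedAddCommGroup E]
    [NormedSpace ℂ E] [FiniteDimensional ℂ E] : CompleteSpace E :=
  FiniteDimensional.complete ℂ E

attribute [local instance] completeSpace_of_finiteDimensional_complex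

/-! ### Linear algebra of commutators -/

section LinearAlgebra

variable {G : Type*} [AddCommGroup G] [Module ℝ G]

/-- If `[T, R] = T` in a finite-dimensional space then `T` is nilpotent: `T ^ n` is an eigenvector
of `ad R` for the eigenvalue `-n`, and only finitely many eigenvalues are available. -/
theorem isNilpotent_of_mul_eq_mul_add_self [FiniteDimensional ℝ G] {T R : Module.End ℝ G}
    (h : T * R = R * T + T) : IsNilpotent T := by
  by_contra hT
  have hpow : ∀ n : ℕ, R * T ^ n - T ^ n * R = (-(n : ℝ)) • T ^ n := by
    intro n
    induction n with
    | zero => simp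
    | succ n ih =>
      have e : R * T ^ (n + 1) - T ^ (n + 1) * R =
          (R * T ^ n - T ^ n * R) * T - T ^ n * (T * R - R * T) := by
        rw [pow_succ]; noncomm_ring
      rw [e, ih, h]
      push_cast
      rw [add_sub_cancel_left, smul_mul_assoc, ← pow_succ, neg_add, add_smul, neg_one_smul,
        sub_eq_add_neg]
  let ad : Module.End ℝ (Module.End ℝ G) := LinearMap.mulLeft ℝ R - LinearMap.mulRight ℝ R
  have hli := Module.End.eigenvectors_linearIndependent' ad (fun n : ℕ => -(n : ℝ))
    (fun m n hmn => by simpa using hmn) (fun n => T ^ n) fun n =>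
      ⟨Module.End.mem_eigenspace_iff.2 (by simpa [ad] using hpow n), fun h0 => hT ⟨n, h0⟩⟩
  exact (Set.infinite_univ (α := ℕ)) (Set.finite_univ_iff.2 hli.finite)

/-- A weak form of Engel's theorem: if `T` is a finite-dimensional family of commuting nilpotent
operators and `U` a proper `T`-invariant subspace, then the quotient by `U` contains a nonzero
vector annihilated by `T`. -/
theorem exists_notMem_forall_mem {V : Type*} [AddCommGroup V] [Module ℝ V] [Module.Finite ℝ V]
    (T : V →ₗ[ℝ] Module.End ℝ G) (hcomm : ∀ v w x, T v (T w x) = T w (T v x))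
    (hnil : ∀ v, IsNilpotent (T v)) {U : Submodule ℝ G} (hU : U ≠ ⊤)
    (hinv : ∀ v, ∀ x ∈ U, T v x ∈ U) : ∃ x ∉ U, ∀ v, T v x ∈ U := by
  classical
  have key : ∀ s : Finset V, ∃ x ∉ U, ∀ v ∈ s, T v x ∈ U := by
    intro s
    induction s using Finset.induction with
    | empty =>
      obtain ⟨x, -, hx⟩ := SetLike.exists_of_lt hU.lt_top
      exact ⟨x, hx, by simp⟩
    | insert w s _ ih =>
      obtain ⟨x, hx, hxs⟩ := ih
      obtain ⟨N, hN⟩ := hnil w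
      have hex : ∃ n, (T w ^ n) x ∈ U := ⟨N, by simp [hN]⟩
      have hpos : Nat.find hex ≠ 0 := fun h0 => hx (by simpa [h0] using Nat.find_spec hex)
      obtain ⟨n, hn⟩ := Nat.exists_eq_succ_of_ne_zero hpos
      refine ⟨(T w ^ n) x, Nat.find_min hex (by omega), ?_⟩
      intro v hv
      rcases Finset.mem_insert.1 hv with rfl | hv
      · have := Nat.find_spec hex
        rwa [hn, Nat.succ_eq_add_one, pow_succ', Module.End.mul_apply] at this
      · have hc : T v ((T w ^ n) x) = (T w ^ n) (T v x) := by
          have : Commute (T v) (T w) := LinearMap.ext fun y => hcomm v w y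
          exact LinearMap.congr_fun (this.pow_right n) x
        rw [hc]
        have : ∀ k : ℕ, ∀ y ∈ U, (T w ^ k) y ∈ U := by
          intro k
          induction k with
          | zero => simp
          | succ k ih =>
            intro y hy
            rw [pow_succ', Module.End.mul_apply]
            exact hinv w _ (ih y hy)
        exact this n _ (hxs v hv)
  obtain ⟨s, hs⟩ := (Module.Finite.fg_top : (⊤ : Submodule ℝ V).FG)
  obtain ⟨x, hx, hxs⟩ := key s
  refine ⟨x, hx, fun v => ?_⟩
  have : (⊤ : Submodule ℝ V) ≤ U.comap (T.flip x) := by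
    rw [← hs, Submodule.span_le]
    exact hxs
  exact this (Submodule.mem_top (x := v))

end LinearAlgebra

/-! ### Derivations of `hol(M,a)` -/

section Derivations

variable {E : Type*} [NormedAddCommGroup E] [NormedSpace ℂ E]

theorem coe_mem_hol_iff {M : Set E} {a : E} {f : E → E} :
    (f : Germ (𝓝 a) E) ∈ hol M a ↔
      AnalyticAt ℂ f a ∧ ∀ᶠ z in 𝓝[M] a, f z ∈ tangentSpace M z := by
  constructor
  · rintro ⟨g, hg, hga, hgM⟩
    have hfg : g =ᶠ[𝓝 a] f := (Germ.coe_eq.1 hg).symm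
    refine ⟨hga.congr hfg, ?_⟩
    filter_upwards [hgM, hfg.filter_mono nhdsWithin_le_nhds] with z hz h
    rwa [← h]
  · rintro ⟨h1, h2⟩
    exact ⟨f, rfl, h1, h2⟩

/-- The derivative of the germ of a map `f` along the vector field `X`, that is, the germ of
`z ↦ f'(z)(X(z))`. -/
noncomputable def germDeriv {a : E} (X : E → E) (ξ : Germ (𝓝 a) E) : Germ (𝓝 a) E :=
  ξ.liftOn (fun f => ((fun z => fderiv ℂ f z (X z) : E → E) : Germ (𝓝 a) E)) fun f g h =>
    Germ.coe_eq.2 <| (EventuallyEq.fderiv (𝕜 := ℂ) h).mono fun z hz => by simp only [hz]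

theorem germDeriv_coe {a : E} (X f : E → E) :
    germDeriv X (f : Germ (𝓝 a) E) = ((fun z => fderiv ℂ f z (X z) : E → E) : Germ (𝓝 a) E) := rfl

theorem analyticAt_clm_apply {H G : Type*} [NormedAddCommGroup H] [NormedSpace ℂ H]
    [NormedAddCommGroup G] [NormedSpace ℂ G] [CompleteSpace E] [CompleteSpace H] [CompleteSpace G]
    {A : E → H →L[ℂ] G} {X : E → H} {a : E} (hA : AnalyticAt ℂ A a) (hX : AnalyticAt ℂ X a) :
    AnalyticAt ℂ (fun z => A z (X z)) a :=
  (hA.contDiffAt.clm_apply hX.contDiffAt).analyticAt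

variable [FiniteDimensional ℂ E]

/-- The derivation `germDeriv X` as an operator on `hol(M,a)`, for fields `X` preserving
`hol(M,a)`. -/
noncomputable def derivEnd {M : Set E} {a : E} (X : E → E)
    (hX : ∀ ξ ∈ hol M a, germDeriv X ξ ∈ hol M a) : Module.End ℝ (hol M a) where
  toFun ξ := ⟨germDeriv X ξ, hX ξ ξ.2⟩
  map_add' := by
    rintro ⟨_, f, rfl, hf, hf'⟩ ⟨_, g, rfl, hg, hg'⟩
    refine Subtype.ext (Germ.coe_eq.2 ?_)
    filter_upwards [hf.eventually_analyticAt, hg.eventually_analyticAt] with z h1 h2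
    change fderiv ℂ (f + g) z (X z) = fderiv ℂ f z (X z) + fderiv ℂ g z (X z)
    rw [fderiv_add h1.differentiableAt h2.differentiableAt]
    rfl
  map_smul' := by
    rintro c ⟨_, f, rfl, hf, hf'⟩
    refine Subtype.ext (Germ.coe_eq.2 ?_)
    filter_upwards [hf.eventually_analyticAt] with z h1
    change fderiv ℂ (c • f) z (X z) = c • fderiv ℂ f z (X z)
    rw [fderiv_const_smul h1.differentiableAt]
    rfl

/-- Tangency is inherited by the derivative of `f` along a curve `c` on which `f` takes its values
in the fixed space `T_z M`. -/
theorem fderiv_mem_tangentSpace {M : Set E} {f : E → E} {z X : E} {c : ℝ → E} (h0 : c 0 = z)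
    (hc : HasDerivAt c X 0) (hf : DifferentiableAt ℂ f z)
    (hcM : ∀ᶠ t in 𝓝 (0 : ℝ), f (c t) ∈ tangentSpace M z) :
    fderiv ℂ f z X ∈ tangentSpace M z := by
  subst h0
  refine hasDerivAt_mem_of_isClosed (Submodule.closed_of_finiteDimensional _) ?_ hcM
  exact (hf.hasFDerivAt.restrictScalars ℝ).comp_hasDerivAt (0 : ℝ) hc

variable {V : Submodule ℝ E} {F : Set V}

theorem IsRealForm.germDeriv_imag_mem_hol (hV : IsRealForm V) (a : E) (v : V) :
    ∀ ξ ∈ hol (tube V F) a, germDeriv (fun _ => Complex.I • (v : E)) ξ ∈ hol (tube V F) a := by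
  rintro _ ⟨f, rfl, hf, hfM⟩
  refine coe_mem_hol_iff.2 ⟨analyticAt_clm_apply hf.fderiv analyticAt_const, ?_⟩
  filter_upwards [eventually_mem_nhdsWithin, eventually_eventually_nhdsWithin.2 hfM,
    hf.eventually_analyticAt.filter_mono nhdsWithin_le_nhds] with z hz hzT hfz
  have hd : HasDerivAt (fun t : ℝ => z + t • (Complex.I • (v : E))) (Complex.I • (v : E)) 0 := by
    simpa using ((hasDerivAt_id (0 : ℝ)).smul_const (Complex.I • (v : E))).const_add z
  have hre : ∀ t : ℝ, hV.re (z + t • (Complex.I • (v : E))) = hV.re z := by simp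
  have hmem : ∀ t : ℝ, z + t • (Complex.I • (v : E)) ∈ tube V F := fun t => by
    rw [hV.mem_tube_iff] at hz ⊢
    rwa [hre]
  refine fderiv_mem_tangentSpace (by simp) hd hfz.differentiableAt ?_
  have ht : Tendsto (fun t : ℝ => z + t • (Complex.I • (v : E))) (𝓝 0) (𝓝[tube V F] z) :=
    tendsto_nhdsWithin_iff.2 ⟨by simpa using hd.continuousAt.tendsto, Eventually.of_forall hmem⟩
  filter_upwards [ht.eventually hzT] with t h
  rw [hV.mem_tangentSpace_tube_iff (hmem t), hre] at h
  rwa [hV.mem_tangentSpace_tube_iff hz]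

/-- The Euler field belongs to `hol(M,a)`. -/
theorem IsRealForm.id_mem_hol (hV : IsRealForm V) (hcon : IsConical F) (a : E) :
    ((id : E → E) : Germ (𝓝 a) E) ∈ hol (tube V F) a := by
  refine coe_mem_hol_iff.2 ⟨analyticAt_id, ?_⟩
  filter_upwards [eventually_mem_nhdsWithin] with z hz
  rw [hV.mem_tangentSpace_tube_iff hz]
  exact hcon _ (hV.mem_tube_iff.1 hz)

/-- For small `s`, the tangent spaces of a conical submanifold at `x` and at `exp(s) x` agree. -/
theorem eventually_tangentSpace_exp_smul_le {W : Type*} [NormedAddCommGroup W] [NormedSpace ℝ W]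
    [FiniteDimensional ℝ W] {F : Set W} (hF : IsAnalyticSubmanifold F) (hcon : IsConical F) {x : W}
    (hx : x ∈ F) : ∀ᶠ s in 𝓝 (0 : ℝ), Real.exp s • x ∈ F ∧
      tangentSpace F (Real.exp s • x) ≤ tangentSpace F x := by
  obtain ⟨U, hU, h⟩ := exists_nhds_exp_smul_mem hF hcon hx
  have hc : Tendsto (fun s : ℝ => Real.exp s • x) (𝓝 0) (𝓝 x) := by
    have : Continuous fun s : ℝ => Real.exp s • x := by fun_prop
    simpa using this.tendsto 0
  have hneg : Tendsto (fun s : ℝ => -s) (𝓝 0) (𝓝 0) := by simpa using (continuous_neg.tendsto (0:ℝ))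
  filter_upwards [h, hneg.eventually h, hc.eventually (eventually_eventually_nhds.2 hU)]
    with s hs hs' hsU
  refine ⟨hs x (mem_of_mem_nhds hU) hx, fun v hv => ?_⟩
  have hd : HasFDerivAt (fun y : W => Real.exp (-s) • y)
      (Real.exp (-s) • ContinuousLinearMap.id ℝ W) (Real.exp s • x) :=
    (hasFDerivAt_id _).const_smul _
  have := map_mem_tangentSpace (S' := F) hd ?_ hv
  · have e : Real.exp (-s) • Real.exp s • x = x := by
      rw [smul_smul, ← Real.exp_add]; simp
    rw [e] at this
    simpa [(Real.exp_pos (-s)).ne'] using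
      (Submodule.smul_mem_iff _ (Real.exp_pos (-s)).ne').1 this
  · filter_upwards [eventually_mem_nhdsWithin, hsU.filter_mono nhdsWithin_le_nhds] with y hy hyU
    exact hs' y hyU hy

theorem IsRealForm.germDeriv_id_mem_hol (hV : IsRealForm V) (hF : IsAnalyticSubmanifold F)
    (hcon : IsConical F) (a : E) :
    ∀ ξ ∈ hol (tube V F) a, germDeriv id ξ ∈ hol (tube V F) a := by
  rintro _ ⟨f, rfl, hf, hfM⟩
  refine coe_mem_hol_iff.2 ⟨analyticAt_clm_apply hf.fderiv analyticAt_id, ?_⟩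
  filter_upwards [eventually_mem_nhdsWithin, eventually_eventually_nhdsWithin.2 hfM,
    hf.eventually_analyticAt.filter_mono nhdsWithin_le_nhds] with z hz hzT hfz
  have hd : HasDerivAt (fun t : ℝ => Real.exp t • z) z 0 := by
    simpa using (Real.hasDerivAt_exp 0).smul_const z
  have hF' := eventually_tangentSpace_exp_smul_le hF hcon (hV.mem_tube_iff.1 hz)
  have hmem : ∀ᶠ t in 𝓝 (0 : ℝ), Real.exp t • z ∈ tube V F := by
    filter_upwards [hF'] with t ht
    rw [hV.mem_tube_iff, map_smul]
    exact ht.1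
  refine fderiv_mem_tangentSpace (by simp) hd hfz.differentiableAt ?_
  have ht : Tendsto (fun t : ℝ => Real.exp t • z) (𝓝 0) (𝓝[tube V F] z) :=
    tendsto_nhdsWithin_iff.2 ⟨by simpa using hd.continuousAt.tendsto, hmem⟩
  filter_upwards [ht.eventually hzT, hF', hmem] with t h h' hm
  rw [hV.mem_tangentSpace_tube_iff hm, map_smul] at h
  rw [hV.mem_tangentSpace_tube_iff hz]
  exact h'.2 h

/-- The derivation of `hol(M,a)` given by the imaginary translations in the direction `iv`, linear
in `v ∈ V`. -/
noncomputable def IsRealForm.imagDeriv (hV : IsRealForm V) (F : Set V) (a : E) :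
    V →ₗ[ℝ] Module.End ℝ (hol (tube V F) a) where
  toFun v := derivEnd (fun _ => Complex.I • (v : E)) (hV.germDeriv_imag_mem_hol a v)
  map_add' v w := by
    ext ⟨_, f, rfl, hf⟩
    refine Germ.coe_eq.2 (Eventually.of_forall fun z => ?_)
    change fderiv ℂ f z _ = fderiv ℂ f z _ + fderiv ℂ f z _
    simp
  map_smul' c v := by
    ext ⟨_, f, rfl, hf⟩
    refine Germ.coe_eq.2 (Eventually.of_forall fun z => ?_)
    change fderiv ℂ f z _ = c • fderiv ℂ f z _
    have e : Complex.I • ((c • v : V) : E) = (c : ℂ) • (Complex.I • (v : E)) := by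
      rw [smul_comm]; simp
    rw [e, map_smul]
    simp

theorem fderiv_fderiv_apply {f X : E → E} {z : E} (hf : AnalyticAt ℂ f z)
    (hX : DifferentiableAt ℂ X z) (w : E) :
    fderiv ℂ (fun y => fderiv ℂ f y (X y)) z w =
      fderiv ℂ (fderiv ℂ f) z w (X z) + fderiv ℂ f z (fderiv ℂ X z w) := by
  have h := hf.fderiv.differentiableAt.hasFDerivAt.clm_apply hX.hasFDerivAt
  rw [h.fderiv]
  simp [add_comm]

theorem fderiv_fderiv_comm {f : E → E} {z : E} (hf : AnalyticAt ℂ f z) (v w : E) :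
    fderiv ℂ (fderiv ℂ f) z v w = fderiv ℂ (fderiv ℂ f) z w v :=
  (ContDiffAt.isSymmSndFDerivAt_of_omega hf.contDiffAt).eq v w

theorem IsRealForm.imagDeriv_comm (hV : IsRealForm V) {a : E} (v w : V)
    (ξ : hol (tube V F) a) :
    hV.imagDeriv F a v (hV.imagDeriv F a w ξ) = hV.imagDeriv F a w (hV.imagDeriv F a v ξ) := by
  obtain ⟨_, f, rfl, hf, hfM⟩ := ξ
  refine Subtype.ext (Germ.coe_eq.2 ?_)
  filter_upwards [hf.eventually_analyticAt] with z hz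
  change fderiv ℂ (fun y => fderiv ℂ f y (Complex.I • (w : E))) z (Complex.I • (v : E)) =
    fderiv ℂ (fun y => fderiv ℂ f y (Complex.I • (v : E))) z (Complex.I • (w : E))
  rw [fderiv_fderiv_apply hz (by fun_prop), fderiv_fderiv_apply hz (by fun_prop),
    fderiv_fderiv_comm hz]
  simp

theorem IsRealForm.isNilpotent_imagDeriv (hV : IsRealForm V) (hF : IsAnalyticSubmanifold F)
    (hcon : IsConical F) {a : E} [FiniteDimensional ℝ (hol (tube V F) a)] (v : V) :
    IsNilpotent (hV.imagDeriv F a v) := by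
  refine isNilpotent_of_mul_eq_mul_add_self
    (R := derivEnd id (hV.germDeriv_id_mem_hol hF hcon a)) ?_
  ext ⟨_, f, rfl, hf, hfM⟩
  refine Germ.coe_eq.2 ?_
  filter_upwards [hf.eventually_analyticAt] with z hz
  change fderiv ℂ (fun y => fderiv ℂ f y (id y)) z _ =
    fderiv ℂ (fun y => fderiv ℂ f y _) z z + fderiv ℂ f z _
  rw [fderiv_fderiv_apply hz differentiableAt_id, fderiv_fderiv_apply hz (by fun_prop),
    fderiv_fderiv_comm hz]
  simp

/-- The only constant fields tangent to `M` are those with values in `iV`: if a nonzero `v ∈ V`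
were tangent to `F` then all the fields `h(z) v`, with `h` a holomorphic function, would be tangent
to `M`. In particular this would hold for `exp(l(z)) v` with `l` linear and `l(iv) = 1`, a
fixed vector of the nilpotent operator `hV.imagDeriv F a v`. -/
theorem IsRealForm.const_mem_hol_iff (hV : IsRealForm V) (hF : IsAnalyticSubmanifold F)
    (hcon : IsConical F) {a : E} [FiniteDimensional ℝ (hol (tube V F) a)] {c : E} :
    ((fun _ => c : E → E) : Germ (𝓝 a) E) ∈ hol (tube V F) a ↔ hV.re c = 0 := by
  constructor
  · intro hc
    by_contra hne
    set v := hV.re c with hv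
    obtain ⟨l, hl⟩ := SeparatingDual.exists_eq_one (R := ℂ) (x := Complex.I • (v : E))
      (by simpa using hne)
    have hmem : ((fun z => Complex.exp (l z) • (v : E) : E → E) : Germ (𝓝 a) E) ∈
        hol (tube V F) a := by
      refine coe_mem_hol_iff.2 ⟨(l.analyticAt a).cexp.smul analyticAt_const, ?_⟩
      filter_upwards [(coe_mem_hol_iff.1 hc).2, eventually_mem_nhdsWithin] with z h hz
      rw [hV.mem_tangentSpace_tube_iff hz] at h ⊢
      have e : Complex.exp (l z) • (v : E) = (((Complex.exp (l z)).re • v : V) : E) +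
          Complex.I • (((Complex.exp (l z)).im • v : V) : E) := by
        conv_lhs => rw [← Complex.re_add_im (Complex.exp (l z))]
        rw [add_smul, mul_comm, mul_smul]
        simp
      rw [e, hV.re_mk]
      exact Submodule.smul_mem _ _ h
    obtain ⟨N, hN⟩ := hV.isNilpotent_imagDeriv hF hcon (a := a) v
    have hfix : hV.imagDeriv F a v ⟨_, hmem⟩ = ⟨_, hmem⟩ := by
      refine Subtype.ext (Germ.coe_eq.2 (Eventually.of_forall fun z => ?_))
      have hd := (l.hasFDerivAt (x := z)).cexp.smul_const (v : E)
      change fderiv ℂ (fun y => Complex.exp (l y) • (v : E)) z (Complex.I • (v : E)) = _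
      rw [hd.fderiv]
      simp only [ContinuousLinearMap.smulRight_apply, smul_apply, hl]
      simp
    have hfixN : ∀ n : ℕ, (hV.imagDeriv F a v ^ n) ⟨_, hmem⟩ = ⟨_, hmem⟩ := by
      intro n
      induction n with
      | zero => rfl
      | succ n ih => rw [pow_succ, Module.End.mul_apply, hfix, ih]
    have h0 := hfixN N
    rw [hN] at h0
    have h1 := (Germ.coe_eq.1 (congrArg Subtype.val h0)).self_of_nhds
    have h2 : (0 : E) = Complex.exp (l a) • (v : E) := h1
    have h3 := (smul_eq_zero.1 h2.symm).resolve_left (Complex.exp_ne_zero _)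
    exact hne (by simpa using h3)
  · intro hc
    refine coe_mem_hol_iff.2 ⟨analyticAt_const, ?_⟩
    filter_upwards [eventually_mem_nhdsWithin] with z hz
    rw [hV.mem_tangentSpace_tube_iff hz, hc]
    exact Submodule.zero_mem _

end Derivations

/-! ### Affine and quadratic germs -/

section Affine

variable {E : Type*} [NormedAddCommGroup E] [NormedSpace ℂ E] {V : Submodule ℝ E} {F : Set V}

theorem IsRealForm.eventually_eq_zero [FiniteDimensional ℂ E] (hV : IsRealForm V)
    {G : Type*} [NormedAddCommGroup G] [NormedSpace ℂ G] {A : E → E →L[ℂ] G} {a : E}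
    (h : ∀ v : V, ∀ᶠ z in 𝓝 a, A z (Complex.I • (v : E)) = 0) : ∀ᶠ z in 𝓝 a, A z = 0 := by
  obtain ⟨s, hs⟩ := (Module.Finite.fg_top : (⊤ : Submodule ℝ V).FG)
  filter_upwards [(Filter.eventually_all_finset s).2 fun v _ => h v] with z hz
  have hle : (⊤ : Submodule ℝ V) ≤
      LinearMap.ker (((A z : E →ₗ[ℂ] G).restrictScalars ℝ) ∘ₗ V.subtype) := by
    rw [← hs, Submodule.span_le]
    intro v hv
    simpa using hz v hv
  have h0 : ∀ v : V, A z v = 0 := fun v => hle (Submodule.mem_top (x := v))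
  ext w
  rw [← hV.re_add_im w]
  simp [h0]

theorem eventually_eq_of_fderiv_eq_zero {E G : Type*} [NormedAddCommGroup E] [NormedSpace ℂ E]
    [NormedAddCommGroup G] [NormedSpace ℂ G] [CompleteSpace G] {g : E → G} {a : E}
    (hg : AnalyticAt ℂ g a) (h : ∀ᶠ z in 𝓝 a, fderiv ℂ g z = 0) : ∀ᶠ z in 𝓝 a, g z = g a := by
  obtain ⟨r, hr, hball⟩ := Metric.eventually_nhds_iff_ball.1 (h.and hg.eventually_analyticAt)
  filter_upwards [Metric.ball_mem_nhds a hr] with z hz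
  exact Metric.isOpen_ball.is_const_of_fderiv_eq_zero (𝕜 := ℂ)
    (convex_ball a r).isPreconnected
    (fun y hy => (hball y hy).2.differentiableAt.differentiableWithinAt)
    (fun y hy => (hball y hy).1) hz (Metric.mem_ball_self hr)

theorem eventually_eq_affine [CompleteSpace E] {f : E → E} {a : E} (hf : AnalyticAt ℂ f a)
    (h : ∀ᶠ z in 𝓝 a, fderiv ℂ (fderiv ℂ f) z = 0) :
    ∀ᶠ z in 𝓝 a, f z = f a + fderiv ℂ f a (z - a) := by
  have h1 := eventually_eq_of_fderiv_eq_zero hf.fderiv h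
  have hg : AnalyticAt ℂ (fun z => f z - fderiv ℂ f a z) a :=
    hf.sub ((fderiv ℂ f a).analyticAt a)
  have h2 := eventually_eq_of_fderiv_eq_zero hg ?_
  · filter_upwards [h2] with z hz
    have := sub_eq_iff_eq_add.1 hz
    rw [this, map_sub]
    abel
  · filter_upwards [h1, hf.eventually_analyticAt] with z hz hfz
    rw [fderiv_fun_sub hfz.differentiableAt (by fun_prop), hz]
    simp

/-- A quadratic form that is constant near some point vanishes. -/
theorem quadratic_eq_zero {G : Type*} [NormedAddCommGroup G] [NormedSpace ℂ G]
    {B : E →ₗ[ℂ] E →ₗ[ℂ] G} {a : E} {c : G} (h : ∀ᶠ z in 𝓝 a, B z z = c) (w : E) : B w w = 0 := by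
  have hc : ∀ s : ℝ, Tendsto (fun t : ℝ => a + ((s * t : ℝ) : ℂ) • w) (𝓝[≠] 0) (𝓝 a) := by
    intro s
    have : Continuous fun t : ℝ => a + ((s * t : ℝ) : ℂ) • w := by fun_prop
    have h2 := this.tendsto 0
    simp only [mul_zero, Complex.ofReal_zero, zero_smul, add_zero] at h2
    exact h2.mono_left nhdsWithin_le_nhds
  obtain ⟨t, h1, h2, ht⟩ :=
    ((hc 1).eventually h |>.and ((hc (-1)).eventually h |>.and self_mem_nhdsWithin)).exists
  -- the second difference of the quadratic form at `a`
  have h0 := h.self_of_nhds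
  have e : B (a + ((1 * t : ℝ) : ℂ) • w) (a + ((1 * t : ℝ) : ℂ) • w) +
      B (a + ((-1 * t : ℝ) : ℂ) • w) (a + ((-1 * t : ℝ) : ℂ) • w) - (2 : ℂ) • B a a =
      (2 * (t : ℂ) * t) • B w w := by
    simp only [map_add, LinearMap.add_apply, map_smul, LinearMap.smul_apply, one_mul, neg_mul,
      Complex.ofReal_neg]
    module
  rw [h1, h2, h0, ← two_smul ℂ c, sub_self] at e
  have ht' : (t : ℂ) ≠ 0 := by exact_mod_cast ht
  have : (2 * (t : ℂ) * t) ≠ 0 := by simp [ht']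
  simpa [this] using e.symm

/-- The bilinear map `B` as a multilinear map of two arguments. -/
def bilinToMultilinear (B : E →ₗ[ℂ] E →ₗ[ℂ] E) : MultilinearMap ℂ (fun _ : Fin 2 => E) E where
  toFun m := B (m 0) (m 1)
  map_update_add' m i x y := by fin_cases i <;> simp
  map_update_smul' m i c x := by fin_cases i <;> simp

/-- The bilinear map underlying a multilinear map of two arguments. -/
def multilinearToBilin (p : MultilinearMap ℂ (fun _ : Fin 2 => E) E) : E →ₗ[ℂ] E →ₗ[ℂ] E :=
  have h0 : ∀ v w : E, ![v, w] = Function.update ![0, w] 0 v := fun v w => by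
    ext i; fin_cases i <;> rfl
  have h1 : ∀ v w : E, ![v, w] = Function.update ![v, 0] 1 w := fun v w => by
    ext i; fin_cases i <;> rfl
  LinearMap.mk₂ ℂ (fun v w => p ![v, w])
    (fun v v' w => by rw [h0 (v + v'), p.map_update_add, ← h0, ← h0])
    (fun c v w => by rw [h0 (c • v), p.map_update_smul, ← h0])
    (fun v w w' => by rw [h1 v (w + w'), p.map_update_add, ← h1, ← h1])
    (fun c v w => by rw [h1 v (c • w), p.map_update_smul, ← h1])

theorem multilinearToBilin_apply (p : MultilinearMap ℂ (fun _ : Fin 2 => E) E) (z : E) :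
    multilinearToBilin p z z = p fun _ => z := by
  simp only [multilinearToBilin, LinearMap.mk₂_apply]
  congr 1
  ext i
  fin_cases i <;> rfl

theorem mem_homogeneousFields_two_iff {a : E} {ξ : Germ (𝓝 a) E} :
    ξ ∈ homogeneousFields a 2 ↔
      ∃ B : E →ₗ[ℂ] E →ₗ[ℂ] E, ξ = ((fun z => B z z : E → E) : Germ (𝓝 a) E) := by
  constructor
  · rintro ⟨p, rfl⟩
    exact ⟨multilinearToBilin p, by simp only [multilinearToBilin_apply]⟩
  · rintro ⟨B, rfl⟩
    exact ⟨bilinToMultilinear B, rfl⟩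

theorem mem_homogeneousFields_one_iff {a : E} {ξ : Germ (𝓝 a) E} :
    ξ ∈ homogeneousFields a 1 ↔ ∃ L : E →ₗ[ℂ] E, ξ = ((L : E → E) : Germ (𝓝 a) E) := by
  constructor
  · rintro ⟨p, rfl⟩
    refine ⟨{ toFun := fun z => p fun _ => z
              map_add' := fun x y => ?_
              map_smul' := fun c x => ?_ }, rfl⟩
    · have h : ∀ z : E, (fun _ : Fin 1 => z) = Function.update (fun _ => x) 0 z := fun z => by
        ext i; fin_cases i; simp
      rw [h (x + y), p.map_update_add, ← h x, ← h y]
    · have h : ∀ z : E, (fun _ : Fin 1 => z) = Function.update (fun _ => x) 0 z := fun z => by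
        ext i; fin_cases i; simp
      rw [h (c • x), p.map_update_smul, ← h x]
      rfl
  · rintro ⟨L, rfl⟩
    exact ⟨L.compMultilinearMap (MultilinearMap.ofSubsingleton ℂ E E (0 : Fin 1) LinearMap.id),
      Germ.coe_eq.2 (Eventually.of_forall fun z => by simp)⟩

/-! ### The grading -/

variable [FiniteDimensional ℂ E]

/-- If `f ∈ hol(M,a)` has constant second derivative `B` near `a` then the quadratic field `B(z,z)`
is obtained from `f` by applying `R (R - 1)`, with `R` the derivation along the Euler field. -/
theorem IsRealForm.quadratic_mem_hol (hV : IsRealForm V) (hF : IsAnalyticSubmanifold F)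
    (hcon : IsConical F) {a : E} {f : E → E} (hf : (f : Germ (𝓝 a) E) ∈ hol (tube V F) a)
    (h : ∀ᶠ z in 𝓝 a, fderiv ℂ (fderiv ℂ f) z = fderiv ℂ (fderiv ℂ f) a) :
    ((fun z => fderiv ℂ (fderiv ℂ f) a z z : E → E) : Germ (𝓝 a) E) ∈ hol (tube V F) a := by
  have h1 := hV.germDeriv_id_mem_hol hF hcon a _ hf
  have h2 := Submodule.sub_mem _ (hV.germDeriv_id_mem_hol hF hcon a _ h1) h1
  convert h2 using 1
  refine Germ.coe_eq.2 ?_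
  filter_upwards [h, (coe_mem_hol_iff.1 hf).1.eventually_analyticAt] with z hz hfz
  change _ = fderiv ℂ (fun y => fderiv ℂ f y (id y)) z (id z) - fderiv ℂ f z (id z)
  rw [fderiv_fderiv_apply hfz differentiableAt_id, hz]
  simp

/-- If `g₁ = 0` then `hol(M,a)` consists of affine germs. Otherwise, as the imaginary translations
act by commuting nilpotent operators, some non-affine `f ∈ hol(M,a)` has constant second derivative,
and its quadratic part is a nonzero element of `g₁`. -/
theorem IsRealForm.eventually_eq_affine_of_grade_one (hV : IsRealForm V)
    (hF : IsAnalyticSubmanifold F) (hcon : IsConical F) {a : E}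
    [FiniteDimensional ℝ (hol (tube V F) a)] (hg : grade (tube V F) a 1 = ⊥) {f : E → E}
    (hf : (f : Germ (𝓝 a) E) ∈ hol (tube V F) a) :
    ∀ᶠ z in 𝓝 a, f z = f a + fderiv ℂ f a (z - a) := by
  set T := hV.imagDeriv F a
  let K : Submodule ℝ (hol (tube V F) a) := ⨅ v, ⨅ w, LinearMap.ker (T v * T w)
  have hK : ∀ x, x ∈ K ↔ ∀ v w, T v (T w x) = 0 := by
    intro x; simp [K, Submodule.mem_iInf]
  have hT2 : ∀ {f : E → E} (hf : (f : Germ (𝓝 a) E) ∈ hol (tube V F) a) (v w : V),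
      (T v (T w ⟨f, hf⟩) : Germ (𝓝 a) E) =
        ((fun z => fderiv ℂ (fderiv ℂ f) z (Complex.I • (v : E)) (Complex.I • (w : E)) : E → E) :
          Germ (𝓝 a) E) := by
    intro f hf v w
    refine Germ.coe_eq.2 ?_
    filter_upwards [(coe_mem_hol_iff.1 hf).1.eventually_analyticAt] with z hz
    change fderiv ℂ (fun y => fderiv ℂ f y (Complex.I • (w : E))) z (Complex.I • (v : E)) = _
    rw [fderiv_fderiv_apply hz (by fun_prop)]
    simp
  have hKtop : K = ⊤ := by
    by_contra hne
    obtain ⟨⟨_, f, rfl, hf, hfM⟩, hfK, hTf⟩ := exists_notMem_forall_mem T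
      (fun v w x => hV.imagDeriv_comm v w x) (fun v => hV.isNilpotent_imagDeriv hF hcon v) hne
      (fun u x hx => (hK _).2 fun v w => by
        have e1 := hV.imagDeriv_comm w u x
        have e2 := hV.imagDeriv_comm v u (T w x)
        rw [show T w (T u x) = T u (T w x) from e1,
          show T v (T u (T w x)) = T u (T v (T w x)) from e2,
          (hK x).1 hx v w, map_zero])
    have hmem : (f : Germ (𝓝 a) E) ∈ hol (tube V F) a := ⟨f, rfl, hf, hfM⟩
    have h3 : ∀ᶠ z in 𝓝 a, fderiv ℂ (fderiv ℂ (fderiv ℂ f)) z = 0 := by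
      refine hV.eventually_eq_zero fun u => hV.eventually_eq_zero fun v =>
        hV.eventually_eq_zero fun w => ?_
      have h0 := congrArg Subtype.val ((hK _).1 (hTf w) u v)
      have h1 : (T u (T v (T w ⟨f, hmem⟩)) : Germ (𝓝 a) E) =
          germDeriv (fun _ => Complex.I • (u : E)) (T v (T w ⟨f, hmem⟩) : Germ (𝓝 a) E) := rfl
      have h2 := h1.symm.trans h0
      rw [hT2 hmem, germDeriv_coe] at h2
      filter_upwards [Germ.coe_eq.1 h2, hf.eventually_analyticAt] with z hz hfz
      have hd := ((hfz.fderiv.fderiv.differentiableAt.hasFDerivAt.clm_apply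
        (hasFDerivAt_const (Complex.I • (v : E)) z)).clm_apply
        (hasFDerivAt_const (Complex.I • (w : E)) z)).fderiv
      rw [hd] at hz
      simpa using hz
    have hconst := eventually_eq_of_fderiv_eq_zero hf.fderiv.fderiv h3
    set B := fderiv ℂ (fderiv ℂ f) a with hB
    have hq : ((fun z => B z z : E → E) : Germ (𝓝 a) E) ∈ grade (tube V F) a 1 := by
      refine ⟨hV.quadratic_mem_hol hF hcon hmem hconst, mem_homogeneousFields_two_iff.2 ?_⟩
      exact ⟨(ContinuousLinearMap.coeLM ℂ) ∘ₗ (B : E →ₗ[ℂ] E →L[ℂ] E), rfl⟩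
    rw [hg, Submodule.mem_bot] at hq
    have hq0 : ∀ w, B w w = 0 := quadratic_eq_zero (a := a)
      (B := (ContinuousLinearMap.coeLM ℂ) ∘ₗ (B : E →ₗ[ℂ] E →L[ℂ] E)) (Germ.coe_eq.1 hq)
    have hB0 : ∀ v w, B v w = 0 := by
      intro v w
      have h1 := hq0 (v + w)
      have h2 : B v w = B w v := fderiv_fderiv_comm hf v w
      simp only [map_add, add_apply, hq0, zero_add, add_zero, ← h2] at h1
      have h3 : (2 : ℂ) • B v w = 0 := by rw [two_smul]; exact h1
      simpa using h3
    refine hfK ((hK _).2 fun v w => Subtype.ext ?_)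
    rw [hT2 hmem]
    refine Germ.coe_eq.2 ?_
    filter_upwards [hconst] with z hz
    rw [hz]
    exact hB0 _ _
  have hfa := (coe_mem_hol_iff.1 hf).1
  refine eventually_eq_affine hfa (hV.eventually_eq_zero fun v => hV.eventually_eq_zero fun w => ?_)
  have hfK : (⟨f, hf⟩ : hol (tube V F) a) ∈ K := hKtop ▸ Submodule.mem_top
  exact Germ.coe_eq.1 ((hT2 hf v w).symm.trans (congrArg Subtype.val ((hK _).1 hfK v w)))

end Affine

section Grading

variable {E : Type*} [NormedAddCommGroup E] [NormedSpace ℂ E] [FiniteDimensional ℂ E]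
  {V : Submodule ℝ E} {F : Set V}

/-- A homogeneous map of degree at least two that is affine near some point vanishes there, by
Euler's relation. -/
theorem IsRealForm.grade_eq_bot (hV : IsRealForm V)
    (hF : IsAnalyticSubmanifold F) (hcon : IsConical F) {a : E}
    [FiniteDimensional ℝ (hol (tube V F) a)] (hg : grade (tube V F) a 1 = ⊥) {k : ℕ} (hk : 1 ≤ k) :
    grade (tube V F) a k = ⊥ := by
  refine (Submodule.eq_bot_iff _).2 ?_
  rintro _ ⟨hp, p, rfl⟩
  set f : E → E := fun z => p fun _ => z
  have haff := hV.eventually_eq_affine_of_grade_one hF hcon hg hp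
  set A := fderiv ℂ f a
  have hEuler : ∀ᶠ z in 𝓝 a, ((k + 1 : ℕ) : ℂ) • f z = A z := by
    filter_upwards [haff.eventually_nhds] with z hz
    have hc : Tendsto (fun t : ℂ => t • z) (𝓝 1) (𝓝 z) := by
      have : Continuous fun t : ℂ => t • z := by fun_prop
      simpa using this.tendsto 1
    have h1 : HasDerivAt (fun t : ℂ => f (t • z)) (((k + 1 : ℕ) : ℂ) • f z) 1 := by
      have e : (fun t : ℂ => f (t • z)) = fun t => t ^ (k + 1) • f z := by
        funext t
        simpa using p.map_smul_univ (fun _ => t) (fun _ => z)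
      rw [e]
      simpa using (hasDerivAt_pow (k + 1) (1 : ℂ)).smul_const (f z)
    have h2 : HasDerivAt (fun t : ℂ => f a + A (t • z - a)) (A z) 1 := by
      have := (((hasDerivAt_id (1 : ℂ)).smul_const z).sub_const a)
      simpa using (A.hasFDerivAt.comp_hasDerivAt (1 : ℂ) this).const_add (f a)
    exact h1.unique (h2.congr_of_eventuallyEq (hc.eventually hz))
  have h3 : ∀ᶠ z in 𝓝 a, ((k : ℂ) • A) z = ((k + 1 : ℕ) : ℂ) • (A a - f a) := by
    filter_upwards [haff, hEuler] with z hz hz'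
    rw [hz, map_sub] at hz'
    rw [smul_apply]
    have : (k : ℂ) • A z = ((k + 1 : ℕ) : ℂ) • A z - A z := by push_cast; module
    rw [this]
    nth_rewrite 2 [← hz']
    module
  have h4 := EventuallyEq.fderiv_eq (𝕜 := ℂ) h3
  rw [ContinuousLinearMap.fderiv, fderiv_fun_const] at h4
  have hk0 : (k : ℂ) ≠ 0 := by exact_mod_cast (by omega : k ≠ 0)
  have hA : A = 0 := by simpa [hk0] using h4
  refine Germ.coe_eq.2 (hEuler.mono fun z hz => ?_)
  rw [hA] at hz
  have hk1 : ((k + 1 : ℕ) : ℂ) ≠ 0 := by exact_mod_cast Nat.succ_ne_zero k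
  simpa only [zero_apply, smul_eq_zero, hk1, false_or] using hz

theorem IsRealForm.im_eq_zero_of_linear_mem_hol (hV : IsRealForm V)
    (hF : IsAnalyticSubmanifold F) (hcon : IsConical F) {a : E}
    [FiniteDimensional ℝ (hol (tube V F) a)] {L : E →L[ℂ] E}
    (hL : ((L : E → E) : Germ (𝓝 a) E) ∈ hol (tube V F) a) (v : V) : hV.im (L v) = 0 := by
  have h := hV.germDeriv_imag_mem_hol a v _ hL
  rw [germDeriv_coe] at h
  simp only [ContinuousLinearMap.fderiv] at h
  rw [hV.const_mem_hol_iff hF hcon, map_smul, hV.re_I_smul] at h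
  simpa using h

/-- Elements of `g₀` are complex linear extensions of endomorphisms of `V`: the bracket of a linear
field `λ(z)` with the constant field `iv` is the constant field `λ(iv)`, which has its values in
`iV`. -/
theorem IsRealForm.exists_mem_gradeZeroEnd (hV : IsRealForm V)
    (hF : IsAnalyticSubmanifold F) (hcon : IsConical F) {a : E}
    [FiniteDimensional ℝ (hol (tube V F) a)] {ξ : Germ (𝓝 a) E} (hξ : ξ ∈ grade (tube V F) a 0) :
    ∃ l ∈ gradeZeroEnd V (tube V F) a, ∃ L : E →ₗ[ℂ] E,
      (∀ v : V, L v = l v) ∧ ξ = ((L : E → E) : Germ (𝓝 a) E) := by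
  obtain ⟨h1, h2⟩ := hξ
  obtain ⟨L, rfl⟩ := mem_homogeneousFields_one_iff.1 h2
  let l : V →ₗ[ℝ] V := (hV.re : E →ₗ[ℝ] V) ∘ₗ L.restrictScalars ℝ ∘ₗ V.subtype
  have hl : ∀ v : V, L v = l v := fun v =>
    hV.eq_coe_re (hV.im_eq_zero_of_linear_mem_hol hF hcon (L := L.toContinuousLinearMap) h1 v)
  exact ⟨l, ⟨L, hl, h1, h2⟩, L, hl, rfl⟩

/-! ### Linearity of the stability group -/

/-- The fields in `hol(M,a)` may be pushed forward by germs `h` of automorphisms, here with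
inverse `k`. -/
theorem pushforward_mem_hol {M : Set E} {a : E} {h k f : E → E} (hh : AnalyticAt ℂ h a)
    (hk : AnalyticAt ℂ k a) (hka : k a = a) (hhM : ∀ᶠ z in 𝓝[M] a, h z ∈ M)
    (hkM : ∀ᶠ z in 𝓝[M] a, k z ∈ M) (hhk : ∀ᶠ z in 𝓝 a, h (k z) = z)
    (hf : (f : Germ (𝓝 a) E) ∈ hol M a) :
    ((fun z => fderiv ℂ h (k z) (f (k z)) : E → E) : Germ (𝓝 a) E) ∈ hol M a := by
  obtain ⟨hfa, hfM⟩ := coe_mem_hol_iff.1 hf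
  refine coe_mem_hol_iff.2 ⟨?_, ?_⟩
  · refine analyticAt_clm_apply (AnalyticAt.fun_comp ?_ hk) (AnalyticAt.fun_comp ?_ hk)
    · rw [hka]; exact hh.fderiv
    · rwa [hka]
  · have hkt : Tendsto k (𝓝[M] a) (𝓝[M] a) := by
      refine tendsto_nhdsWithin_iff.2 ⟨?_, hkM⟩
      have := hk.continuousAt.tendsto
      rw [hka] at this
      exact this.mono_left nhdsWithin_le_nhds
    filter_upwards [hkt.eventually hfM, hkt.eventually (eventually_eventually_nhdsWithin.2 hhM),
      hkt.eventually (hh.eventually_analyticAt.filter_mono nhdsWithin_le_nhds),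
      hhk.filter_mono nhdsWithin_le_nhds] with z h1 h2 h3 h4
    have := map_mem_tangentSpace (h3.differentiableAt.hasFDerivAt.restrictScalars ℝ) h2 h1
    rw [h4] at this
    exact this

/-- A map `g` with `g'(z)(z - a) = g(z) - g(a)` near `a` is affine near `a`: the quotient
`(g(a + tu) - g(a)) / t` does not depend on `t > 0`. -/
theorem eventually_eq_affine_of_euler {g : E → E} {a : E} (hg : AnalyticAt ℂ g a)
    (h : ∀ᶠ z in 𝓝 a, fderiv ℂ g z (z - a) = g z - g a) :
    ∀ᶠ z in 𝓝 a, g z = g a + fderiv ℂ g a (z - a) := by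
  obtain ⟨r, hr, hball⟩ := Metric.eventually_nhds_iff_ball.1 (h.and hg.eventually_analyticAt)
  filter_upwards [Metric.ball_mem_nhds a hr] with z hz
  set u := z - a with hu
  have hmem : ∀ t ∈ Set.Icc (0 : ℝ) 1, a + t • u ∈ Metric.ball a r := by
    intro t ht
    have := (convex_ball a r).add_smul_sub_mem (Metric.mem_ball_self hr) hz ht
    exact this
  have hline : ∀ t : ℝ, HasDerivAt (fun t : ℝ => a + t • u) u t := fun t => by
    simpa using ((hasDerivAt_id t).smul_const u).const_add a
  have hgl : ∀ t ∈ Set.Icc (0 : ℝ) 1,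
      HasDerivAt (fun t : ℝ => g (a + t • u)) (fderiv ℂ g (a + t • u) u) t := by
    intro t ht
    have h1 : HasFDerivAt g ((fderiv ℂ g (a + t • u)).restrictScalars ℝ) (a + t • u) :=
      (hball _ (hmem t ht)).2.differentiableAt.hasFDerivAt.restrictScalars ℝ
    exact h1.comp_hasDerivAt t (hline t)
  let q : ℝ → E := fun t => t⁻¹ • (g (a + t • u) - g a)
  have hq : ∀ t ∈ Set.Ioc (0 : ℝ) 1,
      HasDerivWithinAt q ((fun _ => 0 : ℝ → E) t) (Set.Ioc 0 1) t := by
    intro t ht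
    have h1 := (hasDerivAt_inv ht.1.ne').fun_smul ((hgl t ⟨ht.1.le, ht.2⟩).sub_const (g a))
    have h2 := (hball _ (hmem t ⟨ht.1.le, ht.2⟩)).1
    rw [add_sub_cancel_left, ContinuousLinearMap.map_smul_of_tower] at h2
    have h3 : t⁻¹ • fderiv ℂ g (a + t • u) u + -(t ^ 2)⁻¹ • (g (a + t • u) - g a) = 0 := by
      rw [← h2, smul_smul, ← add_smul]
      have : t⁻¹ + -(t ^ 2)⁻¹ * t = 0 := by
        field_simp [ht.1.ne']; ring
      rw [this, zero_smul]
    rw [h3] at h1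
    exact h1.hasDerivWithinAt
  have hqc : ∀ t ∈ Set.Ioc (0 : ℝ) 1, q t = q 1 := by
    intro t ht
    have := (convex_Ioc (0 : ℝ) 1).norm_image_sub_le_of_norm_hasDerivWithin_le (C := 0) hq
      (by simp) (Set.right_mem_Ioc.2 one_pos) ht
    simpa [sub_eq_zero] using this
  have hlim : Tendsto q (𝓝[>] 0) (𝓝 (fderiv ℂ g a u)) := by
    have := (hgl 0 (by simp)).tendsto_slope_zero_right
    simpa [q] using this
  have hlim' : Tendsto q (𝓝[>] 0) (𝓝 (q 1)) :=
    tendsto_const_nhds.congr'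
      (eventually_of_mem (Ioc_mem_nhdsGT one_pos) fun t ht => (hqc t ht).symm)
  have h1 := tendsto_nhds_unique hlim hlim'
  rw [h1]
  simp [q, hu]

/-- If `g₁ = 0` then every automorphism germ `h` is linear and real. Since `hol(M,a)` is affine, so
is the push-forward under `h` of the complex field `z - a`, a combination of the fields `z` and
`ia` in `hol(M,a)`. This push-forward vanishes at `a` and has derivative `1` there, hence it is
`z - a` again. So `h` commutes with the dilations centred at `a`, and is affine. The push-forwards
under `h` of the constants `iv` and of the Euler field show that the linear part preserves `V` and
that `h` has no translation part. -/
theorem IsRealForm.exists_linear_of_grade_one (hV : IsRealForm V)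
    (hF : IsAnalyticSubmanifold F) (hcon : IsConical F) {a : V}
    [FiniteDimensional ℝ (hol (tube V F) (a : E))] (hg : grade (tube V F) (a : E) 1 = ⊥)
    {h k : E → E} (hh : AnalyticAt ℂ h a) (hk : AnalyticAt ℂ k a) (hha : h a = a) (hka : k a = a)
    (hhM : ∀ᶠ z in 𝓝[tube V F] (a : E), h z ∈ tube V F)
    (hkM : ∀ᶠ z in 𝓝[tube V F] (a : E), k z ∈ tube V F)
    (hhk : ∀ᶠ z in 𝓝 (a : E), h (k z) = z) (hkh : ∀ᶠ z in 𝓝 (a : E), k (h z) = z) :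
    ∃ A : E →L[ℂ] E, (∀ᶠ z in 𝓝 (a : E), h z = A z) ∧ A a = a ∧ ∀ v : V, hV.im (A v) = 0 := by
  set A := fderiv ℂ h a with hA
  have hpush := fun {f : E → E} => pushforward_mem_hol (f := f) hh hk hka hhM hkM hhk
  have hIv : ∀ v : V, ((fun _ => Complex.I • (v : E) : E → E) : Germ (𝓝 (a : E)) E) ∈
      hol (tube V F) (a : E) := fun v => (hV.const_mem_hol_iff hF hcon).2 (by simp)
  have hid := hV.id_mem_hol hcon (a : E)
  have hht : Tendsto h (𝓝 (a : E)) (𝓝 (a : E)) := by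
    have := hh.continuousAt.tendsto; rwa [hha] at this
  have hkt : Tendsto k (𝓝 (a : E)) (𝓝 (a : E)) := by
    have := hk.continuousAt.tendsto; rwa [hka] at this
  -- `h` is affine
  have haff : ∀ᶠ z in 𝓝 (a : E), h z = a + A (z - a) := by
    have h1 := hV.eventually_eq_affine_of_grade_one hF hcon hg (hpush hid)
    have h2 := hV.eventually_eq_affine_of_grade_one hF hcon hg (hpush (hIv a))
    simp only [id] at h1 h2
    set B := fderiv ℂ (fun z => fderiv ℂ h (k z) (k z)) a +
      Complex.I • fderiv ℂ (fun z => fderiv ℂ h (k z) (Complex.I • (a : E))) a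
    have hI : ∀ (L : E →L[ℂ] E) (w : E), L (w - a) = L w + Complex.I • L (Complex.I • (a : E)) := by
      intro L w
      rw [map_sub, map_smul, smul_smul, Complex.I_mul_I]
      module
    have h3 : (fun z => fderiv ℂ h (k z) (k z - a)) =ᶠ[𝓝 (a : E)] fun z => B (z - a) := by
      filter_upwards [h1, h2] with z e1 e2
      have h0 : fderiv ℂ h (k a) (k a - a) = 0 := by rw [hka, sub_self, map_zero]
      rw [hI] at h0 ⊢
      rw [e1, e2]
      calc _ = (fderiv ℂ h (k a) (k a) + Complex.I • fderiv ℂ h (k a) (Complex.I • (a : E))) +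
            B (z - a) := by
              simp only [B, add_apply, smul_apply]
              module
        _ = _ := by rw [h0, zero_add]
    have hB : B = ContinuousLinearMap.id ℂ E := by
      have e1 : HasFDerivAt (fun z => B (z - a)) B (a : E) := by
        have := B.hasFDerivAt.comp (a : E) ((hasFDerivAt_id (a : E)).sub_const (a : E))
        rwa [ContinuousLinearMap.comp_id] at this
      have hd1 : DifferentiableAt ℂ (fun z => fderiv ℂ h (k z)) a := by
        refine DifferentiableAt.fun_comp' (a : E) ?_ hk.differentiableAt
        rw [hka]; exact hh.fderiv.differentiableAt
      have e2 := hd1.hasFDerivAt.clm_apply (hk.differentiableAt.hasFDerivAt.sub_const (a : E))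
      have e3 := e1.unique (e2.congr_of_eventuallyEq h3.symm)
      have e4 : HasFDerivAt (fun z => h (k z)) (A ∘L fderiv ℂ k a) (a : E) := by
        refine HasFDerivAt.comp (a : E) ?_ hk.differentiableAt.hasFDerivAt
        rw [hka]; exact hh.differentiableAt.hasFDerivAt
      have e5 := e4.unique ((hasFDerivAt_id (a : E)).congr_of_eventuallyEq hhk)
      rw [e3, hka, ← hA, e5]
      ext w
      simp
    have h4 : ∀ᶠ w in 𝓝 (a : E), fderiv ℂ h w (w - a) = h w - h a := by
      filter_upwards [hht.eventually h3, hkh] with w e1 e2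
      simp only [e2] at e1
      rw [e1, hB, hha]
      rfl
    have h5 := eventually_eq_affine_of_euler hh h4
    rwa [hha] at h5
  have hDh : ∀ᶠ z in 𝓝 (a : E), fderiv ℂ h z = A := by
    filter_upwards [haff.eventually_nhds] with z hz
    rw [EventuallyEq.fderiv_eq (𝕜 := ℂ) hz]
    have e1 : HasFDerivAt (fun z => (a : E) + A (z - a)) A z := by
      simpa using (A.hasFDerivAt.comp z ((hasFDerivAt_id z).sub_const (a : E))).const_add (a : E)
    exact e1.fderiv
  have hAV : ∀ v : V, hV.im (A v) = 0 := by
    intro v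
    have h1 := hpush (hIv v)
    have h2 : ((fun z => fderiv ℂ h (k z) (Complex.I • (v : E)) : E → E) : Germ (𝓝 (a : E)) E) =
        ((fun _ => A (Complex.I • (v : E)) : E → E) : Germ (𝓝 (a : E)) E) := by
      refine Germ.coe_eq.2 ?_
      filter_upwards [hkt.eventually hDh] with z hz
      rw [hz]
    rw [h2, hV.const_mem_hol_iff hF hcon, map_smul, hV.re_I_smul] at h1
    simpa using h1
  have hAa : A a = a := by
    have h1 := Submodule.sub_mem _ hid (hpush hid)
    have h2 : ((id : E → E) : Germ (𝓝 (a : E)) E) -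
        ((fun z => fderiv ℂ h (k z) (id (k z)) : E → E) : Germ (𝓝 (a : E)) E) =
        ((fun _ => a - A a : E → E) : Germ (𝓝 (a : E)) E) := by
      refine Germ.coe_eq.2 ?_
      filter_upwards [hkt.eventually hDh, hkt.eventually haff, hhk] with z e1 e2 e3
      change z - fderiv ℂ h (k z) (k z) = a - A a
      rw [e3, map_sub] at e2
      rw [e1]
      nth_rewrite 1 [e2]
      abel
    rw [h2, hV.const_mem_hol_iff hF hcon] at h1
    have h3 : hV.im ((a : E) - A a) = 0 := by simp [hAV]
    have h4 := hV.eq_coe_re h3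
    rw [h1] at h4
    exact (sub_eq_zero.1 (by simpa using h4)).symm
  refine ⟨A, ?_, hAa, hAV⟩
  filter_upwards [haff] with z hz
  rw [hz, map_sub, hAa]
  abel

end Grading

section Stability

theorem image_comp_left_eq_image_comp_right {V : Type*} [AddCommGroup V] [Module ℝ V]
    {S : Submodule ℝ (V →ₗ[ℝ] V)} {g : V ≃ₗ[ℝ] V}
    (h : ∀ l ∈ S, (g : V →ₗ[ℝ] V) ∘ₗ l ∘ₗ (g.symm : V →ₗ[ℝ] V) ∈ S)
    (h' : ∀ l ∈ S, (g.symm : V →ₗ[ℝ] V) ∘ₗ l ∘ₗ (g : V →ₗ[ℝ] V) ∈ S) :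
    (fun l : V →ₗ[ℝ] V => (g : V →ₗ[ℝ] V) ∘ₗ l) '' (S : Set (V →ₗ[ℝ] V)) =
      (fun l : V →ₗ[ℝ] V => l ∘ₗ (g : V →ₗ[ℝ] V)) '' (S : Set (V →ₗ[ℝ] V)) := by
  ext m
  constructor
  · rintro ⟨l, hl, rfl⟩
    exact ⟨_, h l hl, by ext v; simp⟩
  · rintro ⟨l, hl, rfl⟩
    exact ⟨_, h' l hl, by ext v; simp⟩

variable {E : Type*} [NormedAddCommGroup E] [NormedSpace ℂ E]

/-- The invertible element of `Aut(M,a)` given by two mutually inverse maps. -/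
def Stab.mk {M : Set E} {a : E} {h k : E → E} (hh : AnalyticAt ℂ h a)
    (hk : AnalyticAt ℂ k a) (hha : h a = a) (hka : k a = a)
    (hhM : ∀ᶠ z in 𝓝[M] a, h z ∈ M) (hkM : ∀ᶠ z in 𝓝[M] a, k z ∈ M)
    (hhk : ∀ᶠ z in 𝓝 a, h (k z) = z) (hkh : ∀ᶠ z in 𝓝 a, k (h z) = z) : Stab M a where
  val := ⟨h, h, rfl, hh, hha, hhM⟩
  inv := ⟨k, k, rfl, hk, hka, hkM⟩
  val_inv := Subtype.ext (Germ.coe_eq.2 hhk)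
  inv_val := Subtype.ext (Germ.coe_eq.2 hkh)

theorem Stab.exists_rep {M : Set E} {a : E} (h : Stab M a) :
    ∃ f k : E → E, h.val.val = f ∧ h.inv.val = k ∧ AnalyticAt ℂ f a ∧ AnalyticAt ℂ k a ∧
      f a = a ∧ k a = a ∧ (∀ᶠ z in 𝓝[M] a, f z ∈ M) ∧ (∀ᶠ z in 𝓝[M] a, k z ∈ M) ∧
      (∀ᶠ z in 𝓝 a, f (k z) = z) ∧ ∀ᶠ z in 𝓝 a, k (f z) = z := by
  obtain ⟨⟨_, f, rfl, hf, hfa, hfM⟩, ⟨_, k, rfl, hk, hka, hkM⟩, h1, h2⟩ := h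
  exact ⟨f, k, rfl, rfl, hf, hk, hfa, hka, hfM, hkM, Germ.coe_eq.1 (congrArg Subtype.val h1),
    Germ.coe_eq.1 (congrArg Subtype.val h2)⟩

theorem SelfGerm.differential_eq {M : Set E} {a : E} {φ : SelfGerm M a} {f : E → E}
    (h : φ.val = f) : φ.differential = fderiv ℂ f a := by
  obtain ⟨φ, hφ⟩ := φ
  subst h
  rfl

theorem SelfGerm.differential_mul {M : Set E} {a : E} (φ ψ : SelfGerm M a) :
    (φ * ψ).differential = φ.differential ∘L ψ.differential := by
  obtain ⟨_, f, rfl, hf, hfa, hfM⟩ := φ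
  obtain ⟨_, g, rfl, hg, hga, hgM⟩ := ψ
  have hf' : AnalyticAt ℂ f (g a) := by rwa [hga]
  have := fderiv_comp a hf'.differentiableAt hg.differentiableAt
  rw [hga] at this
  exact this

theorem SelfGerm.differential_one {M : Set E} {a : E} :
    (1 : SelfGerm M a).differential = ContinuousLinearMap.id ℂ E := fderiv_id

theorem eq_of_eventually_eq_linear {A B : E →L[ℂ] E} {a : E} (h : ∀ᶠ z in 𝓝 a, A z = B z) :
    A = B := by
  have := EventuallyEq.fderiv_eq (𝕜 := ℂ) h
  simpa using this

variable [FiniteDimensional ℂ E] {V : Submodule ℝ E} {F : Set V}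

/-- The automorphism of `V` given by mutually inverse complex linear maps that preserve `V`. -/
noncomputable def IsRealForm.restrictEquiv (hV : IsRealForm V) {A B : E →L[ℂ] E}
    (hAB : ∀ z, A (B z) = z) (hBA : ∀ z, B (A z) = z) (hA : ∀ v : V, hV.im (A v) = 0)
    (hB : ∀ v : V, hV.im (B v) = 0) : V ≃ₗ[ℝ] V :=
  LinearEquiv.ofLinearMap
    ((hV.re : E →ₗ[ℝ] V) ∘ₗ (A : E →ₗ[ℂ] E).restrictScalars ℝ ∘ₗ V.subtype)
    ((hV.re : E →ₗ[ℝ] V) ∘ₗ (B : E →ₗ[ℂ] E).restrictScalars ℝ ∘ₗ V.subtype)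
    (LinearMap.ext fun v => by
      change hV.re (A (hV.re (B v))) = v
      rw [← hV.eq_coe_re (hB v), hAB, hV.re_coe])
    (LinearMap.ext fun v => by
      change hV.re (B (hV.re (A v))) = v
      rw [← hV.eq_coe_re (hA v), hBA, hV.re_coe])

theorem IsRealForm.coe_restrictEquiv (hV : IsRealForm V) {A B : E →L[ℂ] E}
    (hAB : ∀ z, A (B z) = z) (hBA : ∀ z, B (A z) = z) (hA : ∀ v : V, hV.im (A v) = 0)
    (hB : ∀ v : V, hV.im (B v) = 0) (v : V) :
    (hV.restrictEquiv hAB hBA hA hB v : E) = A v :=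
  (hV.eq_coe_re (hA v)).symm

theorem IsRealForm.stabIsLinear (hV : IsRealForm V)
    (hF : IsAnalyticSubmanifold F) (hcon : IsConical F) {a : V}
    [FiniteDimensional ℝ (hol (tube V F) (a : E))] (hg : grade (tube V F) (a : E) 1 = ⊥) :
    StabIsLinear V (tube V F) a := by
  intro h
  obtain ⟨f, k, hf, -, hfa, hka, hf0, hk0, hfM, hkM, hfk, hkf⟩ := h.exists_rep
  obtain ⟨A, hA, hAa, hAV⟩ :=
    hV.exists_linear_of_grade_one hF hcon hg hfa hka hf0 hk0 hfM hkM hfk hkf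
  obtain ⟨B, hB, hBa, hBV⟩ :=
    hV.exists_linear_of_grade_one hF hcon hg hka hfa hk0 hf0 hkM hfM hkf hfk
  have hft : Tendsto f (𝓝 (a : E)) (𝓝 (a : E)) := by
    have := hfa.continuousAt.tendsto; rwa [hf0] at this
  have hkt : Tendsto k (𝓝 (a : E)) (𝓝 (a : E)) := by
    have := hka.continuousAt.tendsto; rwa [hk0] at this
  have hAB : A ∘L B = ContinuousLinearMap.id ℂ E := by
    refine eq_of_eventually_eq_linear (a := (a : E)) ?_
    filter_upwards [hkt.eventually hA, hB, hfk] with z h1 h2 h3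
    simp [← h2, ← h1, h3]
  have hBA : B ∘L A = ContinuousLinearMap.id ℂ E := by
    refine eq_of_eventually_eq_linear (a := (a : E)) ?_
    filter_upwards [hft.eventually hB, hA, hkf] with z h1 h2 h3
    simp [← h2, ← h1, h3]
  have hc := hV.coe_restrictEquiv (fun z => DFunLike.congr_fun hAB z)
    (fun z => DFunLike.congr_fun hBA z) hAV hBV
  refine ⟨hV.restrictEquiv (fun z => DFunLike.congr_fun hAB z)
    (fun z => DFunLike.congr_fun hBA z) hAV hBV, ?_, A, fun v => (hc v).symm, ?_⟩
  · exact Subtype.ext ((hc a).trans hAa)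
  · rw [hf]
    exact Germ.coe_eq.2 hA

/-- If all automorphism germs are linear, then the tangential representation sends such a germ to
the linear map representing it. -/
theorem IsRealForm.tangentialRepIsMono (hV : IsRealForm V) {M : Set E} {a : V}
    (h : StabIsLinear V M a) : TangentialRepIsMono V M (a : E) := by
  choose g hga G hGg hG using h
  have hd : ∀ (φ : Stab M (a : E)) (v : V), φ.val.differential (v : E) = g φ v := by
    intro φ v
    rw [SelfGerm.differential_eq (hG φ), ← hGg]
    exact DFunLike.congr_fun (G φ).toContinuousLinearMap.fderiv (v : E)
  refine ⟨⟨⟨g, ?_⟩, ?_⟩, hd, ?_⟩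
  · ext v
    rw [← hd, Units.val_one, SelfGerm.differential_one]
    rfl
  · intro φ ψ
    ext v
    change ((g (φ * ψ) v : V) : E) = g φ (g ψ v)
    rw [← hd, ← hd, ← hd, Units.val_mul, SelfGerm.differential_mul]
    rfl
  · intro φ ψ e
    have e' : g φ = g ψ := e
    have hGG : G φ = G ψ := hV.linearMap_ext fun v => by rw [hGg, hGg, e']
    refine Units.ext (Subtype.ext ?_)
    rw [hG, hG, hGG]

/-! ### The image of the tangential representation -/

/-- Conjugation by a linear automorphism germ preserves `g₀`. -/
theorem conj_mem_gradeZeroEnd {M : Set E} {a : E} {G K : E →L[ℂ] E} {g k : V →ₗ[ℝ] V}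
    (hGg : ∀ v : V, G v = g v) (hKk : ∀ v : V, K v = k v) (hKa : K a = a)
    (hGM : ∀ᶠ z in 𝓝[M] a, G z ∈ M) (hKM : ∀ᶠ z in 𝓝[M] a, K z ∈ M)
    (hGK : ∀ z, G (K z) = z) {l : V →ₗ[ℝ] V} (hl : l ∈ gradeZeroEnd V M a) :
    g ∘ₗ l ∘ₗ k ∈ gradeZeroEnd V M a := by
  obtain ⟨L, hL, hLhol, -⟩ := hl
  refine ⟨G ∘ₗ L ∘ₗ K, fun v => by simp [hGg, hKk, hL], ?_,
    mem_homogeneousFields_one_iff.2 ⟨_, rfl⟩⟩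
  have h1 := pushforward_mem_hol (G.analyticAt a) (K.analyticAt a) hKa hGM hKM
    (Eventually.of_forall hGK) hLhol
  simp only [ContinuousLinearMap.fderiv] at h1
  exact h1

theorem IsRealForm.map_mem_tangentSpace_of_linear (hV : IsRealForm V) {a : V} {G : E →L[ℂ] E}
    {g : V ≃ₗ[ℝ] V} (hGg : ∀ v : V, G v = g v) (hga : g a = a)
    (hGM : ∀ᶠ z in 𝓝[tube V F] (a : E), G z ∈ tube V F) {v : V} (hv : v ∈ tangentSpace F a) :
    g v ∈ tangentSpace F a := by
  have hd : HasFDerivAt g (g.toLinearMap.toContinuousLinearMap) a :=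
    g.toLinearMap.toContinuousLinearMap.hasFDerivAt
  have := map_mem_tangentSpace (S' := F) hd ?_ hv
  · rw [hga] at this
    exact this
  · have ht : Tendsto ((↑) : V → E) (𝓝[F] a) (𝓝[tube V F] (a : E)) := by
      refine tendsto_nhdsWithin_iff.2 ⟨continuous_subtype_val.continuousWithinAt, ?_⟩
      filter_upwards [eventually_mem_nhdsWithin] with x hx
      exact hV.mem_tube_iff.2 (by rwa [hV.re_coe])
    filter_upwards [ht.eventually hGM] with x hx
    rw [hGg, hV.mem_tube_iff, hV.re_coe] at hx
    exact hx

theorem IsRealForm.mem_normalizerGroup (hV : IsRealForm V) {a : V}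
    (hlin : StabIsLinear V (tube V F) a) {ρ : Stab (tube V F) (a : E) →* (V ≃ₗ[ℝ] V)}
    (hρ : IsTangentialRep V (tube V F) (a : E) ρ) (h : Stab (tube V F) (a : E)) :
    ρ h ∈ normalizerGroup (gradeZeroEnd V (tube V F) (a : E)) a (tangentSpace F a) := by
  have key : ∀ h : Stab (tube V F) (a : E), ∃ G : E →L[ℂ] E, (∀ v : V, G v = ρ h v) ∧ ρ h a = a ∧
      ∀ᶠ z in 𝓝[tube V F] (a : E), G z ∈ tube V F := by
    intro h
    obtain ⟨g, hga, G, hGg, hG⟩ := hlin h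
    have e : ∀ v : V, (G v : E) = ρ h v := by
      intro v
      rw [← hρ, SelfGerm.differential_eq hG]
      exact (DFunLike.congr_fun G.toContinuousLinearMap.fderiv (v : E)).symm
    refine ⟨G.toContinuousLinearMap, e, ?_, ?_⟩
    · refine Subtype.ext ?_
      rw [← e, hGg, hga]
    · obtain ⟨f, -, hf, -, -, -, -, -, hfM, -⟩ := h.exists_rep
      have hfG := Germ.coe_eq.1 (hf.symm.trans hG)
      filter_upwards [hfM, hfG.filter_mono nhdsWithin_le_nhds] with z h1 h2
      rw [h2] at h1
      exact h1
  obtain ⟨G, hGg, hga, hGM⟩ := key h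
  obtain ⟨K, hKk, hka, hKM⟩ := key h⁻¹
  have hinv : ρ h⁻¹ = (ρ h).symm := map_inv ρ h
  rw [hinv] at hKk hka
  have hGK : ∀ z, G (K z) = z := fun z => LinearMap.congr_fun
    (hV.linearMap_ext (L := (G : E →ₗ[ℂ] E) ∘ₗ (K : E →ₗ[ℂ] E)) (K := LinearMap.id)
      fun v => by simp [hKk, hGg]) z
  have hKG : ∀ z, K (G z) = z := fun z => LinearMap.congr_fun
    (hV.linearMap_ext (L := (K : E →ₗ[ℂ] E) ∘ₗ (G : E →ₗ[ℂ] E)) (K := LinearMap.id)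
      fun v => by simp [hKk, hGg]) z
  have hGa : G a = a := by rw [hGg, hga]
  have hKa : K a = a := by rw [hKk, hka]
  refine ⟨image_comp_left_eq_image_comp_right
    (fun l hl => conj_mem_gradeZeroEnd (g := (ρ h : V →ₗ[ℝ] V)) (k := ((ρ h).symm : V →ₗ[ℝ] V))
      hGg hKk hKa hGM hKM hGK hl)
    (fun l hl => conj_mem_gradeZeroEnd (g := ((ρ h).symm : V →ₗ[ℝ] V)) (k := (ρ h : V →ₗ[ℝ] V))
      hKk hGg hGa hKM hGM hKG hl), hga, ?_⟩
  refine Set.Subset.antisymm ?_ ?_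
  · rintro _ ⟨v, hv, rfl⟩
    exact hV.map_mem_tangentSpace_of_linear hGg hga hGM hv
  · intro v hv
    exact ⟨(ρ h).symm v, hV.map_mem_tangentSpace_of_linear hKk hka hKM hv, by simp⟩

end Stability

/-! ### Flows of quadratic vector fields -/

section Flow

open unitInterval

theorem continuous_comp_projIcc {X : Type*} [TopologicalSpace X] (u : C(I, X)) :
    Continuous fun t : ℝ => u (Set.projIcc 0 1 zero_le_one t) :=
  u.continuous.comp continuous_projIcc

variable {E : Type*} [NormedAddCommGroup E] [NormedSpace ℂ E]

/-- The bilinear operator on continuous functions given by the pointwise application of `Q`. -/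
noncomputable def pointwiseBilin (Q : E →L[ℂ] E →L[ℂ] E) : C(I, E) →L[ℂ] C(I, E) →L[ℂ] C(I, E) :=
  LinearMap.mkContinuous₂
    (LinearMap.mk₂ ℂ (fun u v : C(I, E) => (⟨fun t => Q (u t) (v t), by fun_prop⟩ : C(I, E)))
      (fun u u' v => by ext; simp) (fun c u v => by ext; simp)
      (fun u v v' => by ext; simp) (fun c u v => by ext; simp))
    ‖Q‖ fun u v => (ContinuousMap.norm_le _ (by positivity)).2 fun t =>
      (Q.le_opNorm₂ _ _).trans (by gcongr <;> exact ContinuousMap.norm_coe_le_norm _ _)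

/-- The substitution operator `u ↦ A u + Q(u, u)` on continuous functions. -/
noncomputable def quadraticOp (A : E →L[ℂ] E) (Q : E →L[ℂ] E →L[ℂ] E) (u : C(I, E)) : C(I, E) :=
  A.compLeftContinuous ℂ I u + pointwiseBilin Q u u

theorem quadraticOp_apply (A : E →L[ℂ] E) (Q : E →L[ℂ] E →L[ℂ] E) (u : C(I, E)) (t : I) :
    quadraticOp A Q u t = A (u t) + Q (u t) (u t) := rfl

/-- The operator `u ↦ ∫₀ᵗ u(τ) dτ` on the continuous functions on the unit interval. -/
noncomputable def primitive : C(I, E) →L[ℂ] C(I, E) :=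
  LinearMap.mkContinuous
    { toFun := fun u => ⟨fun t => ∫ τ in (0 : ℝ)..t, u (Set.projIcc 0 1 zero_le_one τ),
        (intervalIntegral.continuous_primitive
          (fun a b => (continuous_comp_projIcc u).intervalIntegrable a b) 0).comp
            continuous_subtype_val⟩
      map_add' := fun u v => by
        ext t
        exact intervalIntegral.integral_add ((continuous_comp_projIcc u).intervalIntegrable _ _)
          ((continuous_comp_projIcc v).intervalIntegrable _ _)
      map_smul' := fun c u => by
        ext t
        exact intervalIntegral.integral_smul c _ }
    1 fun u => by
      refine (ContinuousMap.norm_le _ (by positivity)).2 fun t => ?_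
      refine (intervalIntegral.norm_integral_le_of_norm_le_const (C := ‖u‖)
        fun τ _ => u.norm_coe_le_norm _).trans ?_
      rw [sub_zero, abs_of_nonneg t.2.1, one_mul]
      exact mul_le_of_le_one_right (norm_nonneg _) t.2.2

theorem primitive_apply (u : C(I, E)) (t : I) :
    primitive u t = ∫ τ in (0 : ℝ)..t, u (Set.projIcc 0 1 zero_le_one τ) := rfl

theorem hasDerivAt_integral_projIcc [CompleteSpace E] (u : C(I, E)) (t : ℝ) :
    HasDerivAt (fun t : ℝ => ∫ τ in (0 : ℝ)..t, u (Set.projIcc 0 1 zero_le_one τ))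
      (u (Set.projIcc 0 1 zero_le_one t)) t :=
  (continuous_comp_projIcc u).integral_hasStrictDerivAt 0 t |>.hasDerivAt

theorem primitive_const_one [CompleteSpace E] (w : E) :
    primitive (ContinuousMap.const I w) 1 = w := by
  simp [primitive_apply]

/-- Time reversal for primitives. -/
theorem primitive_comp_symm (u v : C(I, E)) (h : ∀ t, v t = u (σ t)) (t : I) :
    primitive v t = primitive u 1 - primitive u (σ t) := by
  have hint := fun a b =>
    (continuous_comp_projIcc u).intervalIntegrable (μ := MeasureTheory.volume) a b
  rw [primitive_apply, primitive_apply, primitive_apply,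
    intervalIntegral.integral_interval_sub_left (hint _ _) (hint _ _)]
  have e : ∀ τ : ℝ, v (Set.projIcc 0 1 zero_le_one τ) =
      (fun x : ℝ => u (Set.projIcc 0 1 zero_le_one x)) (1 - τ) := fun τ => by
    rw [h, symm_projIcc]
  simp_rw [e]
  rw [intervalIntegral.integral_comp_sub_left (fun x : ℝ => u (Set.projIcc 0 1 zero_le_one x)) 1]
  simp

/-- The flow of the quadratic field `A w + Q(w, w)` near its zero `0`. As a function of the time `s`
and the initial value `w`, the trajectory `u = Φ(s, w)` on `[0, s]`, rescaled to `[0, 1]`, is the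
solution of `u(t) = w + s ∫₀ᵗ (A u + Q(u, u))`; the implicit function theorem in the space of
continuous functions gives its existence, uniqueness and analyticity. -/
theorem exists_flow [CompleteSpace E] (A : E →L[ℂ] E) (Q : E →L[ℂ] E →L[ℂ] E) :
    ∃ Φ : ℂ × E → C(I, E), AnalyticAt ℂ Φ 0 ∧ ∀ᶠ p in 𝓝 (0 : (ℂ × E) × C(I, E)),
      (p.2 = ContinuousMap.const I p.1.2 + p.1.1 • primitive (quadraticOp A Q p.2) ↔
        Φ p.1 = p.2) := by
  let Ψ : (ℂ × E) × C(I, E) → C(I, E) := fun p =>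
    p.2 - ContinuousLinearMap.const ℂ I p.1.2 - p.1.1 • primitive (quadraticOp A Q p.2)
  have hΨ : ContDiffAt ℂ ⊤ Ψ 0 := by
    have : ContDiff ℂ ⊤ Ψ := by
      unfold Ψ quadraticOp
      fun_prop
    exact this.contDiffAt
  have hinv : fderiv ℂ Ψ 0 ∘L .inr ℂ (ℂ × E) C(I, E) = ContinuousLinearMap.id ℂ C(I, E) := by
    have h1 : HasFDerivAt Ψ (fderiv ℂ Ψ 0) (ContinuousLinearMap.inr ℂ (ℂ × E) C(I, E) 0) := by
      rw [map_zero]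
      exact (hΨ.differentiableAt (by simp)).hasFDerivAt
    have h2 := h1.comp 0 (ContinuousLinearMap.inr ℂ (ℂ × E) C(I, E)).hasFDerivAt
    have h3 : Ψ ∘ ContinuousLinearMap.inr ℂ (ℂ × E) C(I, E) = id := by
      funext u
      simp [Ψ]
    rw [h3] at h2
    exact h2.unique (hasFDerivAt_id 0)
  have hinv' : (fderiv ℂ Ψ 0 ∘L .inr ℂ (ℂ × E) C(I, E)).IsInvertible := by
    rw [hinv]
    exact ⟨ContinuousLinearEquiv.refl ℂ _, rfl⟩
  refine ⟨hΨ.implicitFunction (by simp) hinv',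
    (hΨ.contDiffAt_implicitFunction (by simp) hinv').analyticAt, ?_⟩
  filter_upwards [hΨ.eventually_apply_eq_iff_implicitFunction (by simp) hinv'] with p hp
  rw [← hp]
  have h0 : Ψ 0 = 0 := by simp [Ψ]
  rw [h0]
  simp only [Ψ, sub_sub, sub_eq_zero]
  rfl

end Flow

section FlowProperties

variable {E : Type*} [NormedAddCommGroup E] [NormedSpace ℂ E]

open unitInterval

/-- The time `s` trajectories of the field `A w + Q(w, w)` starting near its zero `0` are given by
the map `φ`, which is analytic at `0`: close to `0` the integral equation
`u(t) = w + s ∫₀ᵗ (A u + Q(u, u))` has the unique solution `u = φ w`. -/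
structure IsFlowAt (A : E →L[ℂ] E) (Q : E →L[ℂ] E →L[ℂ] E) (s : ℂ)
    (φ : E → C(I, E)) : Prop where
  analyticAt : AnalyticAt ℂ φ 0
  eventually_iff : ∀ᶠ q in 𝓝 (0 : E × C(I, E)),
    (q.2 = ContinuousMap.const I q.1 + s • primitive (quadraticOp A Q q.2) ↔ φ q.1 = q.2)

variable {A : E →L[ℂ] E} {Q : E →L[ℂ] E →L[ℂ] E} {s : ℂ} {φ ψ : E → C(I, E)}

theorem IsFlowAt.apply_zero (h : IsFlowAt A Q s φ) : φ 0 = 0 := by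
  refine h.eventually_iff.self_of_nhds.1 ?_
  ext t
  simp [quadraticOp]

theorem IsFlowAt.tendsto (h : IsFlowAt A Q s φ) : Tendsto φ (𝓝 0) (𝓝 0) := by
  have := h.analyticAt.continuousAt.tendsto
  rwa [h.apply_zero] at this

theorem IsFlowAt.eventually_eq (h : IsFlowAt A Q s φ) :
    ∀ᶠ w in 𝓝 0, φ w = ContinuousMap.const I w + s • primitive (quadraticOp A Q (φ w)) := by
  have ht : Tendsto (fun w => (w, φ w)) (𝓝 0) (𝓝 (0 : E × C(I, E))) :=
    tendsto_id.prodMk_nhds h.tendsto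
  filter_upwards [ht.eventually h.eventually_iff] with w hw
  exact hw.2 rfl

/-- The maps for the times `s` and `-s` are inverse to each other, by time reversal and
uniqueness of the solution. -/
theorem IsFlowAt.eventually_neg_comp (h : IsFlowAt A Q s φ) (h' : IsFlowAt A Q (-s) ψ) :
    ∀ᶠ w in 𝓝 0, ψ (φ w 1) 1 = w := by
  let r : C(I, I) := ⟨σ, continuous_symm⟩
  have hr : Tendsto (fun u : C(I, E) => u.comp r) (𝓝 0) (𝓝 0) := by
    have := (ContinuousMap.continuous_precomp r (Z := E)).tendsto 0
    exact this
  have h1 : Tendsto (fun u : C(I, E) => u 1) (𝓝 0) (𝓝 0) :=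
    (ContinuousMap.evalCLM ℂ (1 : I) : C(I, E) →L[ℂ] E).continuous.tendsto 0
  have ht : Tendsto (fun w => (φ w 1, (φ w).comp r)) (𝓝 0) (𝓝 (0 : E × C(I, E))) :=
    (h1.comp h.tendsto).prodMk_nhds (hr.comp h.tendsto)
  filter_upwards [ht.eventually h'.eventually_iff, h.eventually_eq] with w h2 h3
  rw [h2.1]
  · have : φ w 0 = w := by
      conv_lhs => rw [h3]
      simp [primitive_apply]
    simpa [r] using this
  · ext t
    have e : ∀ t, φ w t = w + s • primitive (quadraticOp A Q (φ w)) t := fun t => by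
      conv_lhs => rw [h3]
      rfl
    change φ w (σ t) = φ w 1 + (-s) • primitive (quadraticOp A Q ((φ w).comp r)) t
    rw [primitive_comp_symm (quadraticOp A Q (φ w)) _ (fun t => rfl), e 1, e (σ t)]
    module

/-- The linearised integral equation. -/
theorem IsFlowAt.fderiv_eq (h : IsFlowAt A Q s φ) (w : E) :
    fderiv ℂ φ 0 w = ContinuousMap.const I w +
      s • primitive (A.compLeftContinuous ℂ I (fderiv ℂ φ 0 w)) := by
  set D := fderiv ℂ φ 0
  have hd : HasFDerivAt φ D 0 := h.analyticAt.differentiableAt.hasFDerivAt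
  have h1 : HasFDerivAt (fun w => pointwiseBilin Q (φ w) (φ w)) (0 : E →L[ℂ] C(I, E)) 0 := by
    have := (pointwiseBilin Q).hasFDerivAt_of_bilinear hd hd
    refine this.congr_fderiv ?_
    ext w : 1
    simp [h.apply_zero]
  have h2 : HasFDerivAt (fun w => quadraticOp A Q (φ w)) (A.compLeftContinuous ℂ I ∘L D) 0 := by
    have := ((A.compLeftContinuous ℂ I).hasFDerivAt.comp 0 hd).add h1
    rwa [add_zero] at this
  have h3 : HasFDerivAt (fun w => ContinuousMap.const I w + s • primitive (quadraticOp A Q (φ w)))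
      (ContinuousLinearMap.const ℂ I + s • (primitive ∘L (A.compLeftContinuous ℂ I ∘L D))) 0 :=
    (ContinuousLinearMap.const ℂ I).hasFDerivAt.add
      ((primitive.hasFDerivAt.comp 0 h2).const_smul s)
  have h4 := hd.unique (h3.congr_of_eventuallyEq h.eventually_eq)
  conv_lhs => rw [h4]
  rfl

/-- A flow with trivial linear part and trivial time-`s` map, `s ≠ 0`, belongs to the zero field:
compare the terms of second order in the integral equation. -/
theorem IsFlowAt.quadratic_eq_zero [CompleteSpace E] (h : IsFlowAt 0 Q s φ) (hs : s ≠ 0)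
    (hid : ∀ᶠ w in 𝓝 0, φ w 1 = w) (w : E) : Q w w = 0 := by
  have h1 : ∀ᶠ w in 𝓝 0, primitive (pointwiseBilin Q (φ w) (φ w)) 1 = 0 := by
    filter_upwards [hid, h.eventually_eq] with w e1 e2
    have e3 := DFunLike.congr_fun e2 1
    rw [e1] at e3
    have e4 : quadraticOp 0 Q (φ w) = pointwiseBilin Q (φ w) (φ w) := by
      ext t; simp [quadraticOp]
    rw [e4] at e3
    have e5 : s • primitive (pointwiseBilin Q (φ w) (φ w)) 1 = 0 := by
      have : w = w + s • primitive (pointwiseBilin Q (φ w) (φ w)) 1 := e3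
      simpa using this.symm
    exact (smul_eq_zero.1 e5).resolve_left hs
  have hline : HasDerivAt (fun r : ℂ => r • w) w 0 := by
    simpa using (hasDerivAt_id (0 : ℂ)).smul_const w
  have hd : HasFDerivAt φ (fderiv ℂ φ 0) ((0 : ℂ) • w) := by
    rw [zero_smul]; exact h.analyticAt.differentiableAt.hasFDerivAt
  have h2 : HasDerivAt (fun r : ℂ => φ (r • w)) (fderiv ℂ φ 0 w) 0 := hd.comp_hasDerivAt 0 hline
  have hconst : fderiv ℂ φ 0 w = ContinuousMap.const I w := by
    rw [h.fderiv_eq]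
    have : (0 : E →L[ℂ] E).compLeftContinuous ℂ I (fderiv ℂ φ 0 w) = 0 := by ext; simp
    rw [this, map_zero, smul_zero, add_zero]
  rw [hconst] at h2
  have h3 : Tendsto (fun r : ℂ => r⁻¹ • φ (r • w)) (𝓝[≠] 0) (𝓝 (ContinuousMap.const I w)) := by
    simpa [h.apply_zero] using h2.tendsto_slope_zero
  have h4 : Tendsto
      (fun r : ℂ => primitive (pointwiseBilin Q (r⁻¹ • φ (r • w)) (r⁻¹ • φ (r • w))) 1)
      (𝓝[≠] 0) (𝓝 (Q w w)) := by
    have hc : Continuous fun u : C(I, E) => primitive (pointwiseBilin Q u u) 1 := by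
      have : Continuous fun u : C(I, E) => primitive (pointwiseBilin Q u u) := by fun_prop
      exact (ContinuousMap.evalCLM ℂ (1 : I) : C(I, E) →L[ℂ] E).continuous.comp this
    have := (hc.tendsto _).comp h3
    have e : pointwiseBilin Q (ContinuousMap.const I w) (ContinuousMap.const I w) =
      ContinuousMap.const I (Q w w) := rfl
    rwa [e, primitive_const_one] at this
  have hr : Tendsto (fun r : ℂ => r • w) (𝓝[≠] 0) (𝓝 0) := by
    have := hline.continuousAt.tendsto
    rw [zero_smul] at this
    exact this.mono_left nhdsWithin_le_nhds
  refine tendsto_nhds_unique h4 (tendsto_const_nhds.congr' ?_)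
  filter_upwards [hr.eventually h1] with r e
  simp [e]

theorem eventually_isFlowAt [CompleteSpace E] {Φ : ℂ × E → C(I, E)} (hΦ : AnalyticAt ℂ Φ 0)
    (h : ∀ᶠ p in 𝓝 (0 : (ℂ × E) × C(I, E)),
      (p.2 = ContinuousMap.const I p.1.2 + p.1.1 • primitive (quadraticOp A Q p.2) ↔
        Φ p.1 = p.2)) : ∀ᶠ s in 𝓝 (0 : ℂ), IsFlowAt A Q s fun w => Φ (s, w) := by
  have t1 : Tendsto (fun s : ℂ => (s, (0 : E))) (𝓝 0) (𝓝 0) := by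
    have : Continuous fun s : ℂ => (s, (0 : E)) := by fun_prop
    exact this.tendsto 0
  have t2 : Tendsto (fun s : ℂ => ((s, (0 : E)), (0 : C(I, E)))) (𝓝 0) (𝓝 0) := by
    have : Continuous fun s : ℂ => ((s, (0 : E)), (0 : C(I, E))) := by fun_prop
    exact this.tendsto 0
  filter_upwards [t1.eventually hΦ.eventually_analyticAt, t2.eventually h.eventually_nhds]
    with s h1 h2
  refine ⟨?_, ?_⟩
  · exact h1.fun_comp (f := fun w : E => (s, w)) (analyticAt_const.prod analyticAt_id)
  · have : Tendsto (fun q : E × C(I, E) => ((s, q.1), q.2)) (𝓝 0) (𝓝 ((s, 0), 0)) := by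
      have : Continuous fun q : E × C(I, E) => ((s, q.1), q.2) := by fun_prop
      exact this.tendsto 0
    exact this.eventually h2

variable [FiniteDimensional ℂ E] {V : Submodule ℝ E} {F : Set V}

/-- The flow of a field tangent to the tube, in real time, preserves the tube. -/
theorem IsRealForm.eventually_flow_mem_tube (hV : IsRealForm V) (hF : IsAnalyticSubmanifold F)
    {a : V} (ha : a ∈ F) {s : ℝ} (h : IsFlowAt A Q s φ)
    (hX : ((fun z => A (z - a) + Q (z - a) (z - a) : E → E) : Germ (𝓝 (a : E)) E) ∈
      hol (tube V F) (a : E)) :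
    ∀ᶠ z in 𝓝[tube V F] (a : E), (a : E) + φ (z - a) 1 ∈ tube V F := by
  let Z : V × V → E := fun p => (p.1 : E) + Complex.I • (p.2 : E)
  have hZ : ContDiff ℝ 1 Z := by
    have h1 : ContDiff ℝ 1 fun p : V × V => (p.1 : E) := V.subtypeL.contDiff.comp contDiff_fst
    have h2 : ContDiff ℝ 1 fun p : V × V => (p.2 : E) := V.subtypeL.contDiff.comp contDiff_snd
    exact h1.add (h2.const_smul Complex.I)
  have hZa : Z (a, 0) = a := by simp [Z]
  let X : E → E := fun z => A (z - a) + Q (z - a) (z - a)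
  have hXs : ContDiff ℝ 1 X := by
    have : ContDiff ℂ 1 X := by unfold X; fun_prop
    exact this.restrict_scalars ℝ
  have hXZ : ContDiff ℝ 1 fun p => s • hV.re (X (Z p)) :=
    (hV.re.contDiff.comp (hXs.comp hZ)).const_smul s
  obtain ⟨U, hU, hflow⟩ := exists_nhds_integralCurve_mem hF ha (y₀ := (0 : V))
    (X := fun p => s • hV.re (X (Z p)))
    hXZ.contDiffAt (by
      have h1 := (eventually_nhdsWithin_iff.1 (coe_mem_hol_iff.1 hX).2)
      have h2 : Tendsto Z (𝓝 (a, 0)) (𝓝 (a : E)) := by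
        have := hZ.continuous.tendsto (a, 0); rwa [hZa] at this
      filter_upwards [h2.eventually h1] with p hp hpF
      have hpt : Z p ∈ tube V F := ⟨_, hpF, _, rfl⟩
      have := (hV.mem_tangentSpace_tube_iff hpt).1 (hp hpt)
      rw [show hV.re (Z p) = p.1 from hV.re_mk _ _] at this
      exact Submodule.smul_mem _ _ this)
  have hU' : ∀ᶠ e in 𝓝 (0 : E), (hV.re (a + e), hV.im (a + e)) ∈ U := by
    have hc : Continuous fun e : E => (hV.re (a + e), hV.im (a + e)) := by fun_prop
    exact hc.continuousAt.eventually (by simpa using hU)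
  obtain ⟨ε, hε, hball⟩ := Metric.eventually_nhds_iff_ball.1 hU'
  have hsub : Tendsto (fun z : E => z - a) (𝓝[tube V F] (a : E)) (𝓝 0) := by
    have : Continuous fun z : E => z - a := by fun_prop
    have := this.tendsto (a : E)
    rw [sub_self] at this
    exact this.mono_left nhdsWithin_le_nhds
  filter_upwards [eventually_mem_nhdsWithin, hsub.eventually h.eventually_eq,
    (h.tendsto.comp hsub).eventually (Metric.ball_mem_nhds 0 hε)] with z hz hzeq hzball
  set u := φ (z - a) with hu
  let f := quadraticOp A Q u
  let y : ℝ → E := fun t => z + (s : ℂ) • ∫ τ in (0 : ℝ)..t, f (Set.projIcc 0 1 zero_le_one τ)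
  have hy : ∀ t, HasDerivAt y (s • f (Set.projIcc 0 1 zero_le_one t)) t := fun t => by
    have := ((hasDerivAt_integral_projIcc f t).const_smul s).const_add z
    simpa [y] using this
  have hyu : ∀ t : I, y t = a + u t := fun t => by
    rw [hzeq]
    change z + (s : ℂ) • primitive f t = a + (z - a + (s : ℂ) • primitive f t)
    abel
  have hyI : ∀ t (ht : t ∈ Set.Icc (0 : ℝ) 1), y t = a + u ⟨t, ht⟩ := fun t ht => hyu ⟨t, ht⟩
  have hc := hflow (fun t => (hV.re (y t), hV.im (y t))) ?_ ?_ ?_ ?_ 1 (by simp)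
  · have e := hyu 1
    rw [Set.Icc.coe_one] at e
    rw [← e, hV.mem_tube_iff]
    exact hc
  · exact (hV.re.continuous.comp (continuous_iff_continuousAt.2 fun t =>
      (hy t).continuousAt)).continuousOn
  · intro t ht
    have ht' : t ∈ Set.Icc (0 : ℝ) 1 := ⟨ht.1, ht.2.le⟩
    have h1 := (hV.re.hasFDerivAt.comp_hasDerivAt t (hy t)).hasDerivWithinAt (s := Set.Ici t)
    have h2 : hV.re (s • f (Set.projIcc 0 1 zero_le_one t)) =
        s • hV.re (X (Z (hV.re (y t), hV.im (y t)))) := by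
      rw [map_smul, show Z (hV.re (y t), hV.im (y t)) = y t from hV.re_add_im _,
        Set.projIcc_of_mem zero_le_one ht', hyI t ht']
      simp only [X, f, quadraticOp_apply, add_sub_cancel_left]
    rw [h2] at h1
    exact h1
  · intro t ht
    have h1 : u ⟨t, ht⟩ ∈ Metric.ball (0 : E) ε := by
      rw [mem_ball_zero_iff]
      exact (u.norm_coe_le_norm _).trans_lt (mem_ball_zero_iff.1 hzball)
    have := hball _ h1
    rwa [← hyI t ht] at this
  · have : y 0 = z := by simp [y]
    rw [this]
    exact hV.mem_tube_iff.1 hz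

/-- The automorphism germ given by the time-`s` map of a tangent field vanishing at `a`. -/
theorem IsRealForm.exists_stab_of_flow (hV : IsRealForm V) (hF : IsAnalyticSubmanifold F)
    {a : V} (ha : a ∈ F) {s : ℝ} (h : IsFlowAt A Q s φ) (h' : IsFlowAt A Q (-s : ℝ) ψ)
    (hX : ((fun z => A (z - a) + Q (z - a) (z - a) : E → E) : Germ (𝓝 (a : E)) E) ∈
      hol (tube V F) (a : E)) :
    ∃ g : Stab (tube V F) (a : E), g.val.val =
      ((fun z => (a : E) + φ (z - a) 1 : E → E) : Germ (𝓝 (a : E)) E) := by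
  have hsub : Tendsto (fun z : E => z - a) (𝓝 (a : E)) (𝓝 0) := by
    have : Continuous fun z : E => z - a := by fun_prop
    simpa using this.tendsto (a : E)
  have han : ∀ {s : ℂ} {φ : E → C(I, E)}, IsFlowAt A Q s φ →
      AnalyticAt ℂ (fun z => (a : E) + φ (z - a) 1) (a : E) := by
    intro s φ h
    refine analyticAt_const.add ?_
    have h1 : AnalyticAt ℂ φ ((a : E) - a) := by rw [sub_self]; exact h.analyticAt
    have h2 : AnalyticAt ℂ (fun z => φ (z - a)) (a : E) :=
      h1.fun_comp (f := fun z => z - (a : E)) (analyticAt_id.sub analyticAt_const)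
    exact ((ContinuousMap.evalCLM ℂ (1 : I) : C(I, E) →L[ℂ] E).analyticAt _).comp h2
  have h2 : IsFlowAt A Q (-(s : ℂ)) ψ := by simpa using h'
  have h1 : IsFlowAt A Q (-(-(s : ℂ))) φ := by simpa using h
  refine ⟨Stab.mk (han h) (han h') (by simp [h.apply_zero]) (by simp [h'.apply_zero])
    (hV.eventually_flow_mem_tube hF ha h hX) (hV.eventually_flow_mem_tube hF ha h' hX) ?_ ?_, rfl⟩
  · filter_upwards [hsub.eventually (h2.eventually_neg_comp h1)] with z hz
    simp [hz]
  · filter_upwards [hsub.eventually (h.eventually_neg_comp h2)] with z hz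
    simp [hz]

end FlowProperties

/-! ### Quadratic fields and nonlinear automorphisms -/

section Quadratic

variable {E : Type*} [NormedAddCommGroup E] [NormedSpace ℂ E] [FiniteDimensional ℂ E]
  {V : Submodule ℝ E} {F : Set V}

open unitInterval

/-- The polarisation of a field in `g₁` maps `V × V` to `iV`. -/
theorem IsRealForm.re_quadratic_eq_zero (hV : IsRealForm V) (hF : IsAnalyticSubmanifold F)
    (hcon : IsConical F) {a : E} [FiniteDimensional ℝ (hol (tube V F) a)]
    {Q : E →L[ℂ] E →L[ℂ] E}
    (hQ : ((fun z => Q z z : E → E) : Germ (𝓝 a) E) ∈ hol (tube V F) a) (v w : V) :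
    hV.re (Q v w + Q w v) = 0 := by
  have h1 := hV.germDeriv_imag_mem_hol a v _ hQ
  let L : E →L[ℂ] E := Q.flip (Complex.I • (v : E)) + Q (Complex.I • (v : E))
  have h2 : germDeriv (fun _ => Complex.I • (v : E)) ((fun z => Q z z : E → E) : Germ (𝓝 a) E) =
      ((L : E → E) : Germ (𝓝 a) E) := by
    refine Germ.coe_eq.2 (Eventually.of_forall fun z => ?_)
    have := (Q.hasFDerivAt_of_bilinear (hasFDerivAt_id z) (hasFDerivAt_id z)).fderiv
    simp only [id] at this
    simp only [this]
    simp [L]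
  rw [h2] at h1
  have h3 := hV.im_eq_zero_of_linear_mem_hol hF hcon h1 w
  have h4 : L w = Complex.I • (Q v w + Q w v) := by
    simp [L, add_comm]
  rwa [h4, hV.im_I_smul] at h3

/-- For a quadratic field `q` in `hol(M,a)`, the field `q(z) - q(a)` belongs to `hol(M,a)`. -/
theorem IsRealForm.quadratic_sub_mem_hol (hV : IsRealForm V) (hF : IsAnalyticSubmanifold F)
    (hcon : IsConical F) {a : V} [FiniteDimensional ℝ (hol (tube V F) (a : E))]
    {Q : E →L[ℂ] E →L[ℂ] E}
    (hQ : ((fun z => Q z z : E → E) : Germ (𝓝 (a : E)) E) ∈ hol (tube V F) (a : E)) :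
    ((fun z => Q z z - Q a a : E → E) : Germ (𝓝 (a : E)) E) ∈ hol (tube V F) (a : E) := by
  refine Submodule.sub_mem _ hQ ((hV.const_mem_hol_iff hF hcon).2 ?_)
  have h := hV.re_quadratic_eq_zero hF hcon hQ a a
  rw [← two_smul ℝ (Q a a), map_smul] at h
  simpa using h

theorem IsRealForm.grade_one_eq_bot_of_autAlg (hV : IsRealForm V) (hF : IsAnalyticSubmanifold F)
    (hcon : IsConical F) {a : V} [FiniteDimensional ℝ (hol (tube V F) (a : E))]
    (h : autAlg (tube V F) (a : E) = ⊥) : grade (tube V F) (a : E) 1 = ⊥ := by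
  refine (Submodule.eq_bot_iff _).2 fun ξ hξ => ?_
  obtain ⟨B, rfl⟩ := mem_homogeneousFields_two_iff.1 hξ.2
  have h1 := hV.quadratic_sub_mem_hol hF hcon (Q := B.toContinuousBilinearMap) hξ.1
  have h2 : ((fun z => B z z - B a a : E → E) : Germ (𝓝 (a : E)) E) ∈
      autAlg (tube V F) (a : E) := ⟨h1, by
    change B a a - B a a = 0
    exact sub_self _⟩
  rw [h, Submodule.mem_bot] at h2
  have h3 : ∀ᶠ z in 𝓝 (a : E), B z z = B a a :=
    (Germ.coe_eq.1 h2).mono fun z hz => sub_eq_zero.1 hz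
  exact Germ.coe_eq.2 (Eventually.of_forall (quadratic_eq_zero h3))

/-- If the tangential representation is a monomorphism into `GL(V)` then `g₁ = 0`. A field `q` in
`g₁` gives the field `q(z) - q(a) = A(z - a) + q(z - a)` with `A(V) ⊆ iV`, whose flow consists of
automorphisms fixing `a`. The tangential representation maps the flow to `exp(sA)`, so `A` also
preserves `V` and hence vanishes. Then the flow has trivial image under the tangential
representation, so it is trivial, and so is `q`. -/
theorem IsRealForm.grade_one_eq_bot_of_mono (hV : IsRealForm V) (hF : IsAnalyticSubmanifold F)
    (hcon : IsConical F) {a : V} (ha : a ∈ F) [FiniteDimensional ℝ (hol (tube V F) (a : E))]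
    (h : TangentialRepIsMono V (tube V F) (a : E)) : grade (tube V F) (a : E) 1 = ⊥ := by
  obtain ⟨ρ, hρ, hinj⟩ := h
  refine (Submodule.eq_bot_iff _).2 fun ξ hξ => ?_
  obtain ⟨B, rfl⟩ := mem_homogeneousFields_two_iff.1 hξ.2
  let Q : E →L[ℂ] E →L[ℂ] E := B.toContinuousBilinearMap
  have hQ : ((fun z => Q z z : E → E) : Germ (𝓝 (a : E)) E) ∈ hol (tube V F) (a : E) := hξ.1
  suffices hQ0 : ∀ w, Q w w = 0 from Germ.coe_eq.2 (Eventually.of_forall hQ0)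
  obtain ⟨A, hA⟩ : ∃ A : E →L[ℂ] E, A = Q a + Q.flip a := ⟨_, rfl⟩
  have hX : ((fun z => A (z - a) + Q (z - a) (z - a) : E → E) : Germ (𝓝 (a : E)) E) ∈
      hol (tube V F) (a : E) := by
    convert hV.quadratic_sub_mem_hol hF hcon hQ using 3 with z
    simp only [hA, add_apply, ContinuousLinearMap.flip_apply, map_sub, sub_apply]
    abel
  obtain ⟨Φ, hΦ, hΦiff⟩ := exists_flow A Q
  have hreal : Tendsto (fun s : ℝ => (s : ℂ)) (𝓝 0) (𝓝 0) := by
    simpa using Complex.continuous_ofReal.tendsto 0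
  have hneg : Tendsto (fun s : ℝ => ((-s : ℝ) : ℂ)) (𝓝 0) (𝓝 0) := by
    have : Continuous fun s : ℝ => ((-s : ℝ) : ℂ) := by fun_prop
    simpa using this.tendsto 0
  have hflow := eventually_isFlowAt hΦ hΦiff
  have hgood : ∀ᶠ s : ℝ in 𝓝 0, IsFlowAt A Q s (fun w => Φ (s, w)) ∧
      IsFlowAt A Q (-s : ℝ) (fun w => Φ ((-s : ℝ), w)) :=
    (hreal.eventually hflow).and (hneg.eventually hflow)
  have hpair : Tendsto (fun s : ℝ => ((s : ℂ), (0 : E))) (𝓝 0) (𝓝 0) := by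
    have : Continuous fun s : ℝ => ((s : ℂ), (0 : E)) := by fun_prop
    exact this.tendsto' 0 0 (by simp)
  let D : ℝ → E →L[ℂ] C(I, E) := fun s => fderiv ℂ (fun w => Φ (s, w)) 0
  have hstab : ∀ᶠ s : ℝ in 𝓝 0, ∃ g : Stab (tube V F) (a : E),
      g.val.val = ((fun z => (a : E) + Φ (s, z - a) 1 : E → E) : Germ (𝓝 (a : E)) E) ∧
      ∀ w, g.val.differential w = D s w 1 := by
    filter_upwards [hgood] with s hs
    obtain ⟨g, hg⟩ := hV.exists_stab_of_flow hF ha hs.1 hs.2 hX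
    refine ⟨g, hg, fun w => ?_⟩
    rw [SelfGerm.differential_eq hg]
    have h1 : HasFDerivAt (fun w => Φ (s, w)) (D s) ((a : E) - a) := by
      rw [sub_self]; exact hs.1.analyticAt.differentiableAt.hasFDerivAt
    have h2 : HasFDerivAt (fun z => Φ (s, z - a)) (D s) (a : E) := by
      have := h1.comp (f := fun z => z - (a : E)) (a : E)
        ((hasFDerivAt_id (a : E)).sub_const (a : E))
      rwa [ContinuousLinearMap.comp_id] at this
    have h3 := ((ContinuousMap.evalCLM ℂ (1 : I) : C(I, E) →L[ℂ] E).hasFDerivAt.comp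
      (a : E) h2).const_add (a : E)
    exact DFunLike.congr_fun h3.fderiv w
  -- the derivative of the tangential representation of the flow at time `0`
  have hAV : ∀ v : V, A v = 0 := by
    intro v
    have hD : Tendsto (fun s : ℝ => D s v) (𝓝 0) (𝓝 (ContinuousMap.const I (v : E))) := by
      have h1 : Tendsto (fun s : ℝ => fderiv ℂ Φ ((s : ℂ), 0) (0, (v : E))) (𝓝 0)
          (𝓝 (fderiv ℂ Φ 0 (0, (v : E)))) :=
        ((ContinuousLinearMap.apply ℂ C(I, E) ((0 : ℂ), (v : E))).continuous.tendsto _).comp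
          (hΦ.fderiv.continuousAt.tendsto.comp hpair)
      have h2 : ∀ᶠ s : ℝ in 𝓝 0, fderiv ℂ Φ ((s : ℂ), 0) (0, (v : E)) = D s v := by
        filter_upwards [hpair.eventually hΦ.eventually_analyticAt] with s hs
        have h3 : HasFDerivAt (fun w : E => ((s : ℂ), w)) (ContinuousLinearMap.inr ℂ ℂ E) 0 :=
          hasFDerivAt_prodMk_right _ _
        have h4 := hs.differentiableAt.hasFDerivAt.comp 0 h3
        exact (DFunLike.congr_fun h4.fderiv (v : E)).symm
      have h5 : fderiv ℂ Φ 0 (0, (v : E)) = ContinuousMap.const I (v : E) := by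
        have h6 := h2.self_of_nhds
        have h7 := hgood.self_of_nhds.1.fderiv_eq (v : E)
        rw [Complex.ofReal_zero, zero_smul, add_zero] at h7
        rw [Complex.ofReal_zero] at h6
        exact h6.trans (by simpa [D] using h7)
      rw [h5] at h1
      exact h1.congr' h2
    have hlim : Tendsto (fun s : ℝ => hV.im (primitive (A.compLeftContinuous ℂ I (D s v)) 1))
        (𝓝[≠] 0) (𝓝 (hV.im (A v))) := by
      have hc : Continuous fun u : C(I, E) => hV.im (primitive (A.compLeftContinuous ℂ I u) 1) := by
        have h1 : Continuous fun u : C(I, E) => primitive (A.compLeftContinuous ℂ I u) := by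
          fun_prop
        exact hV.im.continuous.comp
          ((ContinuousMap.evalCLM ℂ (1 : I) : C(I, E) →L[ℂ] E).continuous.comp h1)
      have h1 := (hc.tendsto _).comp (hD.mono_left (nhdsWithin_le_nhds (s := {0}ᶜ)))
      have h2 : A.compLeftContinuous ℂ I (ContinuousMap.const I (v : E)) =
          ContinuousMap.const I (A v) := rfl
      rwa [h2, primitive_const_one] at h1
    have him : hV.im (A v) = 0 := by
      refine tendsto_nhds_unique hlim (tendsto_const_nhds.congr' ?_)
      filter_upwards [hgood.filter_mono nhdsWithin_le_nhds,
        hstab.filter_mono nhdsWithin_le_nhds, self_mem_nhdsWithin] with s hs ⟨g, hg, hgD⟩ hs0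
      have h1 : hV.im (D s v 1) = 0 := by
        rw [← hgD, hρ, hV.im_coe]
      have h2 := DFunLike.congr_fun (hs.1.fderiv_eq (v : E)) 1
      have h3 : D s v 1 = v + s • primitive (A.compLeftContinuous ℂ I (D s v)) 1 := h2
      rw [h3, map_add, hV.im_coe, zero_add, map_smul] at h1
      exact ((smul_eq_zero.1 h1).resolve_left hs0).symm
    have hre : hV.re (A v) = 0 := by
      have := hV.re_quadratic_eq_zero hF hcon hQ a v
      simpa [hA] using this
    rw [hV.eq_coe_re him, hre]
    rfl
  have hA0 : A = 0 := by
    have := hV.linearMap_ext (L := (A : E →ₗ[ℂ] E)) (K := 0) (by simpa using hAV)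
    ext w
    exact LinearMap.congr_fun this w
  clear hA
  subst hA0
  obtain ⟨s, hs, ⟨g, hg, hgD⟩, hs0⟩ :=
    ((hgood.filter_mono nhdsWithin_le_nhds).and ((hstab.filter_mono nhdsWithin_le_nhds).and
      (self_mem_nhdsWithin (a := (0 : ℝ)) (s := {0}ᶜ)))).exists
  have hs0' : (s : ℂ) ≠ 0 := by exact_mod_cast hs0
  have hDs : ∀ w, D s w 1 = w := by
    intro w
    have h1 := DFunLike.congr_fun (hs.1.fderiv_eq w) 1
    have h2 : (0 : E →L[ℂ] E).compLeftContinuous ℂ I (D s w) = 0 := by ext; simp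
    change D s w 1 =
      w + (s : ℂ) • primitive ((0 : E →L[ℂ] E).compLeftContinuous ℂ I (D s w)) 1 at h1
    rw [h1, h2]
    simp
  have hg1 : g = 1 := by
    refine hinj ?_
    rw [map_one]
    ext v
    rw [← hρ, hgD, hDs]
    rfl
  rw [hg1] at hg
  have hid : ∀ᶠ z in 𝓝 (a : E), z = (a : E) + Φ (s, z - a) 1 := Germ.coe_eq.1 hg
  have hadd : Tendsto (fun w : E => (a : E) + w) (𝓝 0) (𝓝 (a : E)) := by
    have : Continuous fun w : E => (a : E) + w := by fun_prop
    simpa using this.tendsto 0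
  refine hs.1.quadratic_eq_zero hs0' ?_
  filter_upwards [hadd.eventually hid] with w hw
  simpa using hw.symm

end Quadratic

end TubeCR

theorem proposition4p6 {E : Type*} [NormedAddCommGroup E] [NormedSpace ℂ E] [FiniteDimensional ℂ E]
    (V : Submodule ℝ E) (hV : TubeCR.IsRealForm V)
    (F : Set V) (hF : TubeCR.IsAnalyticSubmanifold F) (hconn : IsConnected F)
    (hcon : TubeCR.IsConical F) (a : V) (ha : a ∈ F)
    (M : Set E) (hM : M = TubeCR.tube V F)
    (hfin : FiniteDimensional ℝ (TubeCR.hol M (a : E))) :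
    List.TFAE [
      TubeCR.grade M (a : E) 1 = ⊥,
      ∀ k : ℕ, 1 ≤ k → TubeCR.grade M (a : E) k = ⊥,
      TubeCR.StabIsLinear V M a,
      TubeCR.TangentialRepIsMono V M (a : E)] ∧
    (TubeCR.autAlg M (a : E) = ⊥ →
      TubeCR.grade M (a : E) 1 = ⊥ ∧
      (∀ k : ℕ, 1 ≤ k → TubeCR.grade M (a : E) k = ⊥) ∧
      TubeCR.StabIsLinear V M a ∧
      TubeCR.TangentialRepIsMono V M (a : E)) ∧
    -- every element of `g₀` is the complex linear extension of an endomorphism of `V`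
    (∀ ξ ∈ TubeCR.grade M (a : E) 0, ∃ l ∈ TubeCR.gradeZeroEnd V M (a : E), ∃ L : E →ₗ[ℂ] E,
      (∀ v : V, L v = l v) ∧ ξ = ((L : E → E) : Filter.Germ (nhds (a : E)) E)) ∧
    ∀ ρ : TubeCR.Stab M (a : E) →* (V ≃ₗ[ℝ] V),
      TubeCR.IsTangentialRep V M (a : E) ρ → Function.Injective ρ →
        ρ.range ≤ TubeCR.normalizerGroup (TubeCR.gradeZeroEnd V M (a : E)) a
          (TubeCR.tangentSpace F a) := by
  subst hM
  have h13 := fun h => hV.stabIsLinear hF hcon (a := a) h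
  have h34 := fun h => hV.tangentialRepIsMono (M := TubeCR.tube V F) (a := a) h
  have h41 := fun h => hV.grade_one_eq_bot_of_mono hF hcon ha h
  have h12 := fun h (k : ℕ) (hk : 1 ≤ k) => hV.grade_eq_bot hF hcon (a := (a : E)) h hk
  refine ⟨?_, fun h => ?_, fun ξ hξ => hV.exists_mem_gradeZeroEnd hF hcon hξ, ?_⟩
  · tfae_have 1 → 2 := h12
    tfae_have 2 → 3 := fun h => h13 (h 1 le_rfl)
    tfae_have 3 → 4 := h34
    tfae_have 4 → 1 := h41
    tfae_finish
  · have h1 := hV.grade_one_eq_bot_of_autAlg hF hcon h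
    exact ⟨h1, h12 h1, h13 h1, h34 (h13 h1)⟩
  · rintro ρ hρ hinj _ ⟨h, rfl⟩
    exact hV.mem_normalizerGroup (h13 (h41 ⟨ρ, hρ, hinj⟩)) hρ h
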